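/- For an integer $s\ge 0$ and $\gamma\in\mathbb R$ let $H^s_\gamma(\mathbb R^2)$ be the completion of $C_0^\infty(\mathbb R^2,\mathbb C)$ with respect to the norm $$\|u\|_{H^s_\gamma}=\sum_{|\alpha|\le s}\big\|\langle x\rangle^{\gamma}D^\alpha u\big\|_{L^2(\mathbb R^2)},\qquad \langle x\rangle=(1+|x|^2)^{1/2}.$$ For $n\in\mathbb N\cup\{0\}$ let $h^s_{n,\gamma}\subset H^s_\gamma(\mathbb R^2)$ be the subspace of those $u$ that have, in polar coordinates, the form $u(r,\theta)=u_n(r)e^{in\theta}$ almost everywhere; $u_n$ is called the radial profile of $u$. For $n=0$ this is the subspace $H^s_{r,\gamma}(\mathbb R^2)$ of radially symmetric functions. Let $s\ge 2$ be an integer and $\gamma\in\mathbb R$. (a) The operator $\Delta-\mathrm{Id}\colon H^s_\gamma(\mathbb R^2)\to H^{s-2}_\gamma(\mathbb R^2)$ (with $\Delta$ taken in the sense of distributions) is well defined, bounded and invertible with bounded inverse. (b) For every $n\in\mathbb N\cup\{0\}$ the operator $\Delta_n-\mathrm{Id}$, with $\Delta_n=\partial_{rr}+\frac1r\partial_r-\frac{n^2}{r^2}$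 taken in the sense of distributions on $(0,\infty)$ and acting on radial profiles, $u_n(r)e^{in\theta}\mapsto\big((\Delta_n-\mathrm{Id})u_n\big)(r)\,e^{in\theta}$, is well defined and bounded from $h^s_{n,\gamma}$ to $h^{s-2}_{n,\gamma}$, and invertible with bounded inverse. In particular $\Delta_0-\mathrm{Id}\colon H^s_{r,\gamma}(\mathbb R^2)\to H^{s-2}_{r,\gamma}(\mathbb R^2)$ is invertible. -/

import Mathlib

open MeasureTheory Set
open scoped ContDiff Laplacian

noncomputable section

namespace WeightedSobolev

/-- The Euclidean plane. -/
abbrev Plane : Type := EuclideanSpace ℝ (Fin 2)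

/-- Complex-valued smooth functions with compact support on a real normed space. -/
def IsTest {E : Type*} [NormedAddCommGroup E] [NormedSpace ℝ E] (φ : E → ℂ) : Prop :=
  ContDiff ℝ ∞ φ ∧ HasCompactSupport φ

/-- The bracket `⟨x⟩ = (1 + |x|²)^{1/2}`. -/
def bracket (x : Plane) : ℝ := Real.sqrt (1 + ‖x‖ ^ 2)

/-- The partial derivative `∂φ/∂xᵢ`. -/
def pderiv (i : Fin 2) (φ : Plane → ℂ) : Plane → ℂ :=
  fun x => fderiv ℝ φ x (EuclideanSpace.single i 1)

/-- `D^α φ = ∂₁^{α₁} ∂₂^{α₂} φ`. -/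
def multiDeriv (α : ℕ × ℕ) (φ : Plane → ℂ) : Plane → ℂ :=
  (pderiv 0)^[α.1] ((pderiv 1)^[α.2] φ)

/-- The multi-indices `α` with `|α| ≤ s`. -/
abbrev MultiIndex (s : ℕ) : Type := {α : ℕ × ℕ // α.1 + α.2 ≤ s}

instance (s : ℕ) : Fintype (MultiIndex s) :=
  Fintype.ofInjective
    (fun α : MultiIndex s =>
      ((⟨α.1.1, by have := α.2; omega⟩, ⟨α.1.2, by have := α.2; omega⟩) :
        Fin (s + 1) × Fin (s + 1)))
    (by
      rintro ⟨⟨a, b⟩, h⟩ ⟨⟨c, d⟩, h'⟩ H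
      simpa using H)

/-- Families `(v_α)_{|α| ≤ s}` in `L²(ℝ²; ℂ)`, with norm `∑_{|α| ≤ s} ‖v_α‖_{L²}`. -/
abbrev JetSpace (s : ℕ) : Type :=
  PiLp 1 (fun _ : MultiIndex s => Lp ℂ 2 (volume : Measure Plane))

theorem IsTest.pderiv {φ : Plane → ℂ} (h : IsTest φ) (i : Fin 2) : IsTest (pderiv i φ) := by
  refine ⟨?_, ?_⟩
  · have h1 : ContDiff ℝ ∞ (fderiv ℝ φ) := h.1.fderiv_right (by simp)
    exact h1.clm_apply contDiff_const
  · have h1 := h.2.fderiv (𝕜 := ℝ)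
    exact h1.comp_left (g := fun L : Plane →L[ℝ] ℂ => L (EuclideanSpace.single i 1)) (by simp)

theorem IsTest.iterate_pderiv {φ : Plane → ℂ} (h : IsTest φ) (i : Fin 2) (k : ℕ) :
    IsTest ((WeightedSobolev.pderiv i)^[k] φ) := by
  induction k with
  | zero => exact h
  | succ k ih => rw [Function.iterate_succ_apply']; exact ih.pderiv i

theorem IsTest.add {φ ψ : Plane → ℂ} (h : IsTest φ) (h' : IsTest ψ) : IsTest (φ + ψ) :=
  ⟨h.1.add h'.1, h.2.add h'.2⟩

theorem IsTest.smul {φ : Plane → ℂ} (h : IsTest φ) (c : ℂ) : IsTest (c • φ) :=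
  ⟨contDiff_const.smul h.1, h.2.smul_left (f := fun _ => c)⟩

theorem pderiv_add {φ ψ : Plane → ℂ} (h : IsTest φ) (h' : IsTest ψ) (i : Fin 2) :
    pderiv i (φ + ψ) = pderiv i φ + pderiv i ψ := by
  funext x
  have h1 : DifferentiableAt ℝ φ x := h.1.differentiable (by simp) x
  have h2 : DifferentiableAt ℝ ψ x := h'.1.differentiable (by simp) x
  simp [pderiv, fderiv_add h1 h2]

theorem pderiv_smul {φ : Plane → ℂ} (h : IsTest φ) (c : ℂ) (i : Fin 2) :
    pderiv i (c • φ) = c • pderiv i φ := by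
  funext x
  have h1 : DifferentiableAt ℝ φ x := h.1.differentiable (by simp) x
  simp [pderiv, fderiv_const_smul h1 c]

theorem iterate_pderiv_add {φ ψ : Plane → ℂ} (h : IsTest φ) (h' : IsTest ψ) (i : Fin 2) (k : ℕ) :
    (pderiv i)^[k] (φ + ψ) = (pderiv i)^[k] φ + (pderiv i)^[k] ψ := by
  induction k with
  | zero => rfl
  | succ k ih =>
    rw [Function.iterate_succ_apply', ih,
      pderiv_add (h.iterate_pderiv i k) (h'.iterate_pderiv i k),
      Function.iterate_succ_apply', Function.iterate_succ_apply']

theorem iterate_pderiv_smul {φ : Plane → ℂ} (h : IsTest φ) (c : ℂ) (i : Fin 2) (k : ℕ) :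
    (pderiv i)^[k] (c • φ) = c • (pderiv i)^[k] φ := by
  induction k with
  | zero => rfl
  | succ k ih =>
    rw [Function.iterate_succ_apply', ih, pderiv_smul (h.iterate_pderiv i k),
      Function.iterate_succ_apply']

theorem multiDeriv_add {φ ψ : Plane → ℂ} (h : IsTest φ) (h' : IsTest ψ) (α : ℕ × ℕ) :
    multiDeriv α (φ + ψ) = multiDeriv α φ + multiDeriv α ψ := by
  rw [multiDeriv, iterate_pderiv_add h h',
    iterate_pderiv_add (h.iterate_pderiv 1 _) (h'.iterate_pderiv 1 _)]
  rfl

theorem multiDeriv_smul {φ : Plane → ℂ} (h : IsTest φ) (c : ℂ) (α : ℕ × ℕ) :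
    multiDeriv α (c • φ) = c • multiDeriv α φ := by
  rw [multiDeriv, iterate_pderiv_smul h, iterate_pderiv_smul (h.iterate_pderiv 1 _)]
  rfl

/-- The weighted jet of `φ`: the family `(⟨x⟩^γ D^α φ)_{|α| ≤ s}`. Its norm in `JetSpace s` is
`∑_{|α| ≤ s} ‖⟨x⟩^γ D^α φ‖_{L²}`. -/
def IsWeightedJet (s : ℕ) (γ : ℝ) (φ : Plane → ℂ) (v : JetSpace s) : Prop :=
  ∀ α : MultiIndex s, v α =ᵐ[volume] fun x => ((bracket x ^ γ : ℝ) : ℂ) * multiDeriv α.1 φ x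

/-- The space `C₀^∞(ℝ²; ℂ)` with the norm `∑_{|α| ≤ s} ‖⟨x⟩^γ D^α φ‖_{L²}`, realised by its
weighted jets. -/
def testJets (s : ℕ) (γ : ℝ) : Submodule ℂ (JetSpace s) where
  carrier := {v | ∃ φ : Plane → ℂ, IsTest φ ∧ IsWeightedJet s γ φ v}
  zero_mem' := by
    refine ⟨0, ⟨contDiff_const, HasCompactSupport.zero⟩, fun α => ?_⟩
    have h0 : multiDeriv α.1 (0 : Plane → ℂ) = 0 := by
      have h := multiDeriv_smul (φ := 0) ⟨contDiff_const, HasCompactSupport.zero⟩ 0 α.1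
      simpa using h
    filter_upwards [Lp.coeFn_zero ℂ 2 (volume : Measure Plane)] with x hx
    simp [h0]
  add_mem' := by
    rintro v w ⟨φ, hφ, hv⟩ ⟨ψ, hψ, hw⟩
    refine ⟨φ + ψ, hφ.add hψ, fun α => ?_⟩
    filter_upwards [hv α, hw α, Lp.coeFn_add (v α) (w α)] with x h1 h2 h3
    rw [PiLp.add_apply, h3, Pi.add_apply, h1, h2, multiDeriv_add hφ hψ, Pi.add_apply, mul_add]
  smul_mem' := by
    rintro c v ⟨φ, hφ, hv⟩
    refine ⟨c • φ, hφ.smul c, fun α => ?_⟩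
    filter_upwards [hv α, Lp.coeFn_smul c (v α)] with x h1 h3
    rw [PiLp.smul_apply, h3, Pi.smul_apply, h1, multiDeriv_smul hφ, Pi.smul_apply]
    simp only [smul_eq_mul]
    ring

/-- The weighted Sobolev space `H^s_γ(ℝ²)`: the completion of `C₀^∞(ℝ²; ℂ)` for the norm
`∑_{|α| ≤ s} ‖⟨x⟩^γ D^α φ‖_{L²}`, that is, the closure of the weighted jets in the complete
space `JetSpace s`. -/
def Sobolev (s : ℕ) (γ : ℝ) : Submodule ℂ (JetSpace s) :=
  (testJets s γ).topologicalClosure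

/-- The function on the plane represented by an element of `H^s_γ(ℝ²)`: its component of index
`α = 0` divided by the weight. -/
def toFun {s : ℕ} {γ : ℝ} (u : Sobolev s γ) : Plane → ℂ :=
  fun x => ((bracket x ^ (-γ) : ℝ) : ℂ) * (u : JetSpace s) ⟨(0, 0), Nat.zero_le s⟩ x

/-- `Δu - u = f` on the plane in the sense of distributions. -/
def LaplacianSubId (u f : Plane → ℂ) : Prop :=
  ∀ φ : Plane → ℂ, IsTest φ → ∫ x, f x * φ x = ∫ x, u x * ((Δ φ) x - φ x)

/-- `e^{inθ}`, where `θ` is the polar angle of `x`. -/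
def angular (n : ℕ) (x : Plane) : ℂ :=
  Complex.exp (n * (Complex.arg ⟨x 0, x 1⟩ : ℂ) * Complex.I)

/-- `u(r, θ) = p(r) e^{inθ}` almost everywhere. -/
def IsProfile {s : ℕ} {γ : ℝ} (n : ℕ) (p : ℝ → ℂ) (u : Sobolev s γ) : Prop :=
  toFun u =ᵐ[volume] fun x => p ‖x‖ * angular n x

/-- The subspace of those elements of `H^s_γ(ℝ²)` that have the form `p(r) e^{inθ}`. For `n = 0`
it is the subspace of radially symmetric functions. -/
def modeSpace (n s : ℕ) (γ : ℝ) : Submodule ℂ (Sobolev s γ) where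
  carrier := {u | ∃ p : ℝ → ℂ, IsProfile n p u}
  zero_mem' := by
    refine ⟨0, ?_⟩
    unfold IsProfile
    filter_upwards [Lp.coeFn_zero ℂ 2 (volume : Measure Plane)] with x hx
    simp [toFun]
  add_mem' := by
    rintro u v ⟨p, hp⟩ ⟨q, hq⟩
    refine ⟨p + q, ?_⟩
    unfold IsProfile at *
    filter_upwards [hp, hq, Lp.coeFn_add ((u : JetSpace s) ⟨(0, 0), Nat.zero_le s⟩)
      ((v : JetSpace s) ⟨(0, 0), Nat.zero_le s⟩)] with x h1 h2 h3
    have h4 : toFun (u + v) x = toFun u x + toFun v x := by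
      simp only [toFun, Submodule.coe_add, PiLp.add_apply]
      rw [h3, Pi.add_apply, mul_add]
    rw [h4, h1, h2, Pi.add_apply, add_mul]
  smul_mem' := by
    rintro c u ⟨p, hp⟩
    refine ⟨c • p, ?_⟩
    unfold IsProfile at *
    filter_upwards [hp, Lp.coeFn_smul c ((u : JetSpace s) ⟨(0, 0), Nat.zero_le s⟩)] with x h1 h3
    have h4 : toFun (c • u) x = c * toFun u x := by
      simp only [toFun, Submodule.coe_smul, PiLp.smul_apply]
      rw [h3, Pi.smul_apply, smul_eq_mul]
      ring
    rw [h4, h1, Pi.smul_apply, smul_eq_mul, mul_assoc]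

/-- `Δₙ p - p = q` with `Δₙ = ∂_rr + r⁻¹ ∂_r - n² r⁻²`, in the sense of distributions on `(0, ∞)`
(the operator `Δₙ` is formally self-adjoint for `r dr`). -/
def RadialLaplacianSubId (n : ℕ) (p q : ℝ → ℂ) : Prop :=
  ∀ ψ : ℝ → ℂ, IsTest ψ → tsupport ψ ⊆ Ioi 0 →
    ∫ r in Ioi (0 : ℝ), q r * ψ r * r =
      ∫ r in Ioi (0 : ℝ),
        p r * (deriv (deriv ψ) r + deriv ψ r / r - n ^ 2 / r ^ 2 * ψ r - ψ r) * r

end WeightedSobolev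

end

/-! On unweighted `L²`, integration by parts gives `‖(Δ - 1)f‖² = ∑ ‖∂ᵢ∂ⱼf‖² + 2 ∑ ‖∂ᵢf‖² + ‖f‖²`
for Schwartz `f` (`energy_identity`), so `Δ - 1` controls all derivatives of order at most two. To
insert a weight, replace `⟨x⟩^γ` by the equivalent `w = (1 + ε²|x|²)^(γ/2)`. Conjugation by `w`
turns `∂ᵢ` into `∂ᵢ - ∂ᵢw/w`, and `∂ᵢw/w` and its first derivatives are `O(ε)`, so for small `ε` the
errors are absorbed (`conjugated_estimate`, `exists_weighted_estimate`). Since `Δ - 1` commutes with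
`D^α`, the estimate passes to every order `s`.

On Schwartz functions `Δ - 1` is bijective, with inverse the Fourier multiplier `-(1 + 4π²|ξ|²)⁻¹`.
Schwartz functions lie densely in `H^s_γ` (cutoffs show that they belong to the completion), and the
two-sided bounds extend the bijection to an isomorphism `sobolevHelmholtz`. The distributional
equation holds on Schwartz functions and passes to the limit.

For part (b), having the form `p(r)e^{inθ}` is equivalent to being multiplied by `aⁿ` under rotation
by `a` (`mem_modeSpace_iff`). As `Δ - 1` commutes with rotations, the isomorphism restricts to the
mode spaces. Testing the planar equation against `k(|x|²) z̄ⁿ`, with `ψ(r) = k(r²) rⁿ`, and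
integrating in polar coordinates gives the radial equation tested against `ψ`. -/

noncomputable section

namespace WeightedSobolev

open SchwartzMap LineDeriv

open scoped SchwartzMap

/-! ### Schwartz-space operators and the unweighted estimate. -/

/-- The partial derivative `∂ᵢ` on Schwartz functions on the plane. -/
def schwartzDeriv (i : Fin 2) : 𝓢(Plane, ℂ) →L[ℂ] 𝓢(Plane, ℂ) :=
  lineDerivOpCLM ℂ 𝓢(Plane, ℂ) (EuclideanSpace.single i (1 : ℝ))

/-- Multiplication of Schwartz functions by a real function of temperate growth. -/
def schwartzMul (g : Plane → ℝ) : 𝓢(Plane, ℂ) →L[ℂ] 𝓢(Plane, ℂ) :=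
  smulLeftCLM ℂ (fun x => (g x : ℂ))

/-- The embedding of Schwartz functions into `L²`. -/
abbrev schwartzToL2 : 𝓢(Plane, ℂ) →L[ℂ] Lp ℂ 2 (volume : Measure Plane) :=
  toLpCLM ℂ ℂ 2 volume

/-- The operator `Δ - 1` on Schwartz functions. -/
def helmholtz : 𝓢(Plane, ℂ) →L[ℂ] 𝓢(Plane, ℂ) :=
  schwartzDeriv 0 ∘L schwartzDeriv 0 + schwartzDeriv 1 ∘L schwartzDeriv 1 -
    ContinuousLinearMap.id ℂ _

theorem helmholtz_apply (f : 𝓢(Plane, ℂ)) :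
    helmholtz f = schwartzDeriv 0 (schwartzDeriv 0 f) + schwartzDeriv 1 (schwartzDeriv 1 f) - f :=
  rfl

theorem schwartzDeriv_apply (i : Fin 2) (f : 𝓢(Plane, ℂ)) (x : Plane) :
    schwartzDeriv i f x = fderiv ℝ f x (EuclideanSpace.single i 1) :=
  rfl

theorem coe_schwartzDeriv (i : Fin 2) (f : 𝓢(Plane, ℂ)) :
    (schwartzDeriv i f : Plane → ℂ) = pderiv i f :=
  rfl

theorem hasTemperateGrowth_complex_ofReal {g : Plane → ℝ} (hg : g.HasTemperateGrowth) :
    (fun x => (g x : ℂ)).HasTemperateGrowth :=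
  Function.HasTemperateGrowth.comp Function.Complex.hasTemperateGrowth_ofReal hg

theorem schwartzMul_apply {g : Plane → ℝ} (hg : g.HasTemperateGrowth) (f : 𝓢(Plane, ℂ))
    (x : Plane) : schwartzMul g f x = g x * f x := by
  simp [schwartzMul, hasTemperateGrowth_complex_ofReal hg]

theorem schwartzDeriv_schwartzMul {g g' : Plane → ℝ} (hg : g.HasTemperateGrowth)
    (hg' : g'.HasTemperateGrowth) (i : Fin 2)
    (h : ∀ x, fderiv ℝ g x (EuclideanSpace.single i 1) = g' x) (f : 𝓢(Plane, ℂ)) :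
    schwartzDeriv i (schwartzMul g f) =
      schwartzMul g (schwartzDeriv i f) + schwartzMul g' f := by
  ext x
  have e : (schwartzMul g f : Plane → ℂ) = fun y => (g y) • f y := by
    ext y
    simp [schwartzMul_apply hg]
  have hd : DifferentiableAt ℝ g x := (hg.1.differentiable (by simp)) x
  rw [add_apply, schwartzMul_apply hg, schwartzMul_apply hg', schwartzDeriv_apply,
    schwartzDeriv_apply, e, fderiv_fun_smul hd f.differentiableAt]
  simp [← h x]

theorem schwartzDeriv_comm (i j : Fin 2) (f : 𝓢(Plane, ℂ)) :
    schwartzDeriv i (schwartzDeriv j f) = schwartzDeriv j (schwartzDeriv i f) := by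
  ext x
  have h2 : ContDiffAt ℝ 2 f x := f.contDiffAt 2
  have hs : IsSymmSndFDerivAt ℝ f x := h2.isSymmSndFDerivAt minSmoothness_of_isRCLikeNormedField.le
  have hd : DifferentiableAt ℝ (fderiv ℝ f) x :=
    ((f.smooth 2).fderiv_right (m := 1) (by norm_num)).differentiable (by simp) x
  have key : ∀ k l : Fin 2, schwartzDeriv k (schwartzDeriv l f) x =
      fderiv ℝ (fderiv ℝ f) x (EuclideanSpace.single k 1) (EuclideanSpace.single l 1) := by
    intro k l
    rw [schwartzDeriv_apply]
    have e : (schwartzDeriv l f : Plane → ℂ) =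
        fun y => fderiv ℝ f y (EuclideanSpace.single l 1) := rfl
    rw [e, fderiv_clm_apply hd (differentiableAt_const _)]
    simp
  rw [key, key]
  exact hs.eq _ _

theorem inner_schwartzDeriv_left (i : Fin 2) (f g : 𝓢(Plane, ℂ)) :
    inner ℂ (schwartzToL2 (schwartzDeriv i f)) (schwartzToL2 g) =
      -inner ℂ (schwartzToL2 f) (schwartzToL2 (schwartzDeriv i g)) := by
  have h := integral_bilinear_lineDerivOp_right_eq_neg_left (μ := (volume : Measure Plane)) f g
    ((ContinuousLinearMap.mul ℝ ℂ).comp (Complex.conjCLE : ℂ →L[ℝ] ℂ))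
    (EuclideanSpace.single i (1 : ℝ))
  simp only [schwartzToL2, toLpCLM_apply, inner_toL2_toL2_eq]
  rw [eq_neg_iff_add_eq_zero, add_comm, ← eq_neg_iff_add_eq_zero]
  have e : ∀ k : 𝓢(Plane, ℂ), ∂_{EuclideanSpace.single i (1 : ℝ)} k = schwartzDeriv i k :=
    fun _ => rfl
  simpa [mul_comm, e] using h

/-- Expand the square of `Δf - f`. The cross term with `f` becomes the gradient norm after one
integration by parts; the cross term of `∂₀²f` with `∂₁²f` becomes `‖∂₀∂₁f‖²` after two, because
partial derivatives commute. All terms are then nonnegative, so each is bounded by the left side. -/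
theorem energy_identity (f : 𝓢(Plane, ℂ)) :
    ‖schwartzToL2 (helmholtz f)‖ ^ 2 =
      (∑ i, ∑ j, ‖schwartzToL2 (schwartzDeriv i (schwartzDeriv j f))‖ ^ 2) +
        2 * (∑ i, ‖schwartzToL2 (schwartzDeriv i f)‖ ^ 2) + ‖schwartzToL2 f‖ ^ 2 := by
  have h1 : ∀ i, RCLike.re (inner ℂ (schwartzToL2 (schwartzDeriv i (schwartzDeriv i f)))
      (schwartzToL2 f)) = -‖schwartzToL2 (schwartzDeriv i f)‖ ^ 2 := by
    intro i
    rw [inner_schwartzDeriv_left, ← inner_self_eq_norm_sq (𝕜 := ℂ)]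
    simp
  have h2 : RCLike.re (inner ℂ (schwartzToL2 (schwartzDeriv 0 (schwartzDeriv 0 f)))
      (schwartzToL2 (schwartzDeriv 1 (schwartzDeriv 1 f)))) =
      ‖schwartzToL2 (schwartzDeriv 0 (schwartzDeriv 1 f))‖ ^ 2 := by
    rw [inner_schwartzDeriv_left, schwartzDeriv_comm 0 1, ← neg_neg (inner ℂ _ _),
      ← inner_schwartzDeriv_left, neg_neg, schwartzDeriv_comm 1 0,
      ← inner_self_eq_norm_sq (𝕜 := ℂ), schwartzDeriv_comm 0 1]
  have e : schwartzToL2 (helmholtz f) = schwartzToL2 (schwartzDeriv 0 (schwartzDeriv 0 f)) +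
      schwartzToL2 (schwartzDeriv 1 (schwartzDeriv 1 f)) - schwartzToL2 f := by
    rw [helmholtz_apply, map_sub, map_add]
  rw [e, norm_sub_sq (𝕜 := ℂ), norm_add_sq (𝕜 := ℂ), inner_add_left, map_add, h1, h1, h2]
  simp only [Fin.sum_univ_two]
  rw [schwartzDeriv_comm 1 0]
  ring

theorem norm_schwartzDeriv_schwartzDeriv_le (i j : Fin 2) (f : 𝓢(Plane, ℂ)) :
    ‖schwartzToL2 (schwartzDeriv i (schwartzDeriv j f))‖ ≤ ‖schwartzToL2 (helmholtz f)‖ := by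
  refine (sq_le_sq₀ (norm_nonneg _) (norm_nonneg _)).1 ?_
  rw [energy_identity]
  have h := (Finset.single_le_sum
      (f := fun j => ‖schwartzToL2 (schwartzDeriv i (schwartzDeriv j f))‖ ^ 2)
      (fun _ _ => sq_nonneg _) (Finset.mem_univ j)).trans
    (Finset.single_le_sum
      (f := fun i => ∑ j, ‖schwartzToL2 (schwartzDeriv i (schwartzDeriv j f))‖ ^ 2)
      (fun _ _ => Finset.sum_nonneg fun _ _ => sq_nonneg _) (Finset.mem_univ i))
  have h' : 0 ≤ ∑ i, ‖schwartzToL2 (schwartzDeriv i f)‖ ^ 2 :=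
    Finset.sum_nonneg fun _ _ => sq_nonneg _
  nlinarith [sq_nonneg ‖schwartzToL2 f‖]

theorem norm_schwartzDeriv_le (i : Fin 2) (f : 𝓢(Plane, ℂ)) :
    ‖schwartzToL2 (schwartzDeriv i f)‖ ≤ ‖schwartzToL2 (helmholtz f)‖ := by
  refine (sq_le_sq₀ (norm_nonneg _) (norm_nonneg _)).1 ?_
  rw [energy_identity]
  have h := Finset.single_le_sum
      (f := fun i => ‖schwartzToL2 (schwartzDeriv i f)‖ ^ 2)
      (fun _ _ => sq_nonneg _) (Finset.mem_univ i)
  have h' : 0 ≤ ∑ i, ∑ j, ‖schwartzToL2 (schwartzDeriv i (schwartzDeriv j f))‖ ^ 2 :=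
    Finset.sum_nonneg fun _ _ => Finset.sum_nonneg fun _ _ => sq_nonneg _
  nlinarith [sq_nonneg ‖schwartzToL2 f‖, sq_nonneg ‖schwartzToL2 (schwartzDeriv i f)‖]

theorem norm_le_norm_helmholtz (f : 𝓢(Plane, ℂ)) :
    ‖schwartzToL2 f‖ ≤ ‖schwartzToL2 (helmholtz f)‖ := by
  refine (sq_le_sq₀ (norm_nonneg _) (norm_nonneg _)).1 ?_
  rw [energy_identity]
  have h : 0 ≤ ∑ i, ‖schwartzToL2 (schwartzDeriv i f)‖ ^ 2 :=
    Finset.sum_nonneg fun _ _ => sq_nonneg _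
  have h' : 0 ≤ ∑ i, ∑ j, ‖schwartzToL2 (schwartzDeriv i (schwartzDeriv j f))‖ ^ 2 :=
    Finset.sum_nonneg fun _ _ => Finset.sum_nonneg fun _ _ => sq_nonneg _
  linarith

/-! ### The weighted second-order estimate. -/

/-- If conjugation by `W` changes the derivatives by operators that are small in `L²`, then the
`H²` estimate for `Δ - 1` persists with the weight `W`. -/
theorem conjugated_estimate {W : 𝓢(Plane, ℂ) →L[ℂ] 𝓢(Plane, ℂ)}
    {A : Fin 2 → 𝓢(Plane, ℂ) →L[ℂ] 𝓢(Plane, ℂ)}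
    {B : Fin 2 → Fin 2 → 𝓢(Plane, ℂ) →L[ℂ] 𝓢(Plane, ℂ)}
    (hW : ∀ i f, schwartzDeriv i (W f) = W (schwartzDeriv i f) + A i (W f))
    (hA : ∀ i f, ‖schwartzToL2 (A i f)‖ ≤ 1 / 16 * ‖schwartzToL2 f‖)
    (hAB : ∀ i j f, schwartzDeriv i (A j f) = A j (schwartzDeriv i f) + B i j f)
    (hB : ∀ i j f, ‖schwartzToL2 (B i j f)‖ ≤ 1 / 16 * ‖schwartzToL2 f‖) (f : 𝓢(Plane, ℂ)) :
    ‖schwartzToL2 (W f)‖ ≤ 4 * ‖schwartzToL2 (W (helmholtz f))‖ ∧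
      (∀ i, ‖schwartzToL2 (W (schwartzDeriv i f))‖ ≤
        4 * ‖schwartzToL2 (W (helmholtz f))‖) ∧
      ∀ i j, ‖schwartzToL2 (W (schwartzDeriv i (schwartzDeriv j f)))‖ ≤
        4 * ‖schwartzToL2 (W (helmholtz f))‖ := by
  set v := W f with hv
  have e1 : ∀ i, W (schwartzDeriv i f) = schwartzDeriv i v - A i v := fun i => by
    rw [hv, hW, add_sub_cancel_right]
  have e2 : ∀ i j, W (schwartzDeriv i (schwartzDeriv j f)) =
      schwartzDeriv i (schwartzDeriv j v) - A j (schwartzDeriv i v) - B i j v -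
        A i (schwartzDeriv j v) + A i (A j v) := fun i j => by
    rw [eq_sub_of_add_eq (hW i (schwartzDeriv j f)).symm, e1, map_sub, map_sub, hAB]
    abel
  -- Up to these error terms, the weighted function `v = W f` satisfies the unweighted equation, so
  -- the unweighted estimate applies to `v`.
  have e3 : W (helmholtz f) = helmholtz v -
      (A 0 (schwartzDeriv 0 v) + B 0 0 v + A 0 (schwartzDeriv 0 v) - A 0 (A 0 v)) -
      (A 1 (schwartzDeriv 1 v) + B 1 1 v + A 1 (schwartzDeriv 1 v) - A 1 (A 1 v)) := by
    rw [helmholtz_apply, map_sub, map_add, e2, e2, helmholtz_apply]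
    abel
  set N : 𝓢(Plane, ℂ) → ℝ := fun g => ‖schwartzToL2 g‖ with hN
  have hadd : ∀ a b, N (a + b) ≤ N a + N b := fun a b => by
    simp only [hN, map_add]; exact norm_add_le _ _
  have hsub : ∀ a b, N (a - b) ≤ N a + N b := fun a b => by
    simp only [hN, map_sub]; exact norm_sub_le _ _
  have n0 : 0 ≤ N (helmholtz v) := norm_nonneg _
  have b0 : N v ≤ N (helmholtz v) := norm_le_norm_helmholtz v
  have b1 : ∀ i, N (schwartzDeriv i v) ≤ N (helmholtz v) := fun i => norm_schwartzDeriv_le i v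
  have b2 : ∀ i j, N (schwartzDeriv i (schwartzDeriv j v)) ≤ N (helmholtz v) := fun i j =>
    norm_schwartzDeriv_schwartzDeriv_le i j v
  have hA' : ∀ i g, N (A i g) ≤ 1 / 16 * N g := hA
  have hB' : ∀ i j g, N (B i j g) ≤ 1 / 16 * N g := hB
  -- The constant is `3/16 + 1/256`: three terms with one small factor and one with two. The two
  -- directions together give less than `1/2`, hence the factor `2` in `hmain`.
  have herr : ∀ i, N (A i (schwartzDeriv i v) + B i i v + A i (schwartzDeriv i v) -
      A i (A i v)) ≤ 49 / 256 * N (helmholtz v) := fun i => by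
    have := hsub (A i (schwartzDeriv i v) + B i i v + A i (schwartzDeriv i v)) (A i (A i v))
    have := hadd (A i (schwartzDeriv i v) + B i i v) (A i (schwartzDeriv i v))
    have := hadd (A i (schwartzDeriv i v)) (B i i v)
    linarith [hA' i (schwartzDeriv i v), hB' i i v, hA' i (A i v), hA' i v, b1 i]
  have hmain : N (helmholtz v) ≤ 2 * N (W (helmholtz f)) := by
    have e4 : helmholtz v = W (helmholtz f) +
      (A 0 (schwartzDeriv 0 v) + B 0 0 v + A 0 (schwartzDeriv 0 v) - A 0 (A 0 v)) +
      (A 1 (schwartzDeriv 1 v) + B 1 1 v + A 1 (schwartzDeriv 1 v) - A 1 (A 1 v)) := by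
      rw [e3]; abel
    have h1 := hadd (W (helmholtz f) +
      (A 0 (schwartzDeriv 0 v) + B 0 0 v + A 0 (schwartzDeriv 0 v) - A 0 (A 0 v)))
      (A 1 (schwartzDeriv 1 v) + B 1 1 v + A 1 (schwartzDeriv 1 v) - A 1 (A 1 v))
    have h2 := hadd (W (helmholtz f))
      (A 0 (schwartzDeriv 0 v) + B 0 0 v + A 0 (schwartzDeriv 0 v) - A 0 (A 0 v))
    rw [← e4] at h1
    linarith [herr 0, herr 1]
  change N v ≤ 4 * N _ ∧ (∀ i, N _ ≤ 4 * N _) ∧ ∀ i j, N _ ≤ 4 * N _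
  -- Undoing the conjugation costs a factor at most `1 + 49/256 < 2`, and `hmain` costs another `2`;
  -- this is the `4`.
  refine ⟨by linarith, fun i => ?_, fun i j => ?_⟩
  · rw [e1]
    linarith [hsub (schwartzDeriv i v) (A i v), hA' i v, b1 i]
  · rw [e2]
    have := hadd (schwartzDeriv i (schwartzDeriv j v) - A j (schwartzDeriv i v) - B i j v -
        A i (schwartzDeriv j v)) (A i (A j v))
    have := hsub (schwartzDeriv i (schwartzDeriv j v) - A j (schwartzDeriv i v) - B i j v)
      (A i (schwartzDeriv j v))
    have := hsub (schwartzDeriv i (schwartzDeriv j v) - A j (schwartzDeriv i v)) (B i j v)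
    have := hsub (schwartzDeriv i (schwartzDeriv j v)) (A j (schwartzDeriv i v))
    linarith [hA' i (A j v), hA' j v, hA' i (schwartzDeriv j v), hA' j (schwartzDeriv i v),
      hB' i j v, b1 i, b1 j, b2 i j]

theorem norm_schwartzMul_le {g h : Plane → ℝ} (hg : g.HasTemperateGrowth)
    (hh : h.HasTemperateGrowth) {c : ℝ} (hgh : ∀ x, |g x| ≤ c * |h x|)
    (f : 𝓢(Plane, ℂ)) :
    ‖schwartzToL2 (schwartzMul g f)‖ ≤ c * ‖schwartzToL2 (schwartzMul h f)‖ := by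
  refine Lp.norm_le_mul_norm_of_ae_le_mul ?_
  filter_upwards [coeFn_toLp (schwartzMul g f) 2 volume, coeFn_toLp (schwartzMul h f) 2 volume]
    with x h1 h2
  simp only [schwartzToL2, toLpCLM_apply]
  rw [h1, h2, schwartzMul_apply hg, schwartzMul_apply hh, norm_mul, norm_mul, ← mul_assoc]
  simp only [Complex.norm_real, Real.norm_eq_abs]
  gcongr
  exact hgh x

theorem norm_schwartzMul_le_of_bound {g : Plane → ℝ} (hg : g.HasTemperateGrowth)
    {c : ℝ} (hgc : ∀ x, |g x| ≤ c) (f : 𝓢(Plane, ℂ)) :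
    ‖schwartzToL2 (schwartzMul g f)‖ ≤ c * ‖schwartzToL2 f‖ := by
  have h := norm_schwartzMul_le (h := fun _ => 1) hg (.const _)
    (by simpa using hgc) f
  simpa [schwartzMul] using h

theorem bracket_rpow (γ : ℝ) (x : Plane) : bracket x ^ γ = (1 + ‖x‖ ^ 2) ^ (γ / 2) := by
  rw [bracket, Real.sqrt_eq_rpow, ← Real.rpow_mul (by positivity)]
  congr 1
  ring

theorem bracket_pos (x : Plane) : 0 < bracket x := Real.sqrt_pos.2 (by positivity)

theorem hasTemperateGrowth_bracket_rpow (γ : ℝ) :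
    (fun x => bracket x ^ γ).HasTemperateGrowth := by
  simp only [bracket_rpow]
  exact Function.hasTemperateGrowth_one_add_norm_sq_rpow Plane (γ / 2)

/-- The function `(1 + ε²|x|²)^t`. -/
def scaledWeight (ε t : ℝ) (x : Plane) : ℝ := (1 + ‖ε • x‖ ^ 2) ^ t

theorem hasTemperateGrowth_scaledWeight (ε t : ℝ) : (scaledWeight ε t).HasTemperateGrowth :=
  (Function.hasTemperateGrowth_one_add_norm_sq_rpow Plane t).comp
    (ε • ContinuousLinearMap.id ℝ Plane).hasTemperateGrowth

theorem scaledWeight_pos (ε t : ℝ) (x : Plane) : 0 < scaledWeight ε t x :=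
  Real.rpow_pos_of_pos (by positivity) _

theorem scaledWeight_neg_one (ε : ℝ) (x : Plane) :
    scaledWeight ε (-1) x = (1 + ‖ε • x‖ ^ 2)⁻¹ := by
  rw [scaledWeight, Real.rpow_neg_one]

theorem fderiv_scaledWeight (ε t : ℝ) (i : Fin 2) (x : Plane) :
    fderiv ℝ (scaledWeight ε t) x (EuclideanSpace.single i 1) =
      2 * t * ε ^ 2 * x i * scaledWeight ε (-1) x * scaledWeight ε t x := by
  have hpos : (0 : ℝ) < 1 + ε ^ 2 * ‖x‖ ^ 2 := by positivity
  have hw : ∀ t, scaledWeight ε t = fun y : Plane => (1 + ε ^ 2 * ‖y‖ ^ 2) ^ t := fun t => by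
    funext y
    simp [scaledWeight, norm_smul, mul_pow]
  have h1 : HasFDerivAt (fun y : Plane => 1 + ε ^ 2 * ‖y‖ ^ 2)
      (ε ^ 2 • (2 • innerSL ℝ x)) x :=
    ((hasStrictFDerivAt_norm_sq x).hasFDerivAt.const_mul (ε ^ 2)).const_add 1
  have h2 := h1.rpow_const (p := t) (Or.inl hpos.ne')
  rw [hw, hw, h2.fderiv, Real.rpow_sub_one hpos.ne']
  simp [Real.rpow_neg_one, EuclideanSpace.inner_single_right]
  field_simp

/-- This is `y ≤ (1 + y²)/2` with `y = |εx|`. It bounds `∂ᵢw/w` by `|t|ε` uniformly in `x`: one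
factor `ε` is spent on the scaled coordinate and one remains. -/
theorem scaled_coord_le (ε : ℝ) (i : Fin 2) (x : Plane) :
    |ε * x i| * scaledWeight ε (-1) x ≤ 1 / 2 := by
  have h1 : |ε * x i| ≤ ‖ε • x‖ := by
    simpa using PiLp.norm_apply_le (ε • x) i
  rw [scaledWeight_neg_one, ← div_eq_mul_inv, div_le_div_iff₀ (by positivity) (by positivity)]
  nlinarith [sq_nonneg (‖ε • x‖ - 1)]

theorem scaledWeight_neg_one_le_one (ε : ℝ) (x : Plane) : scaledWeight ε (-1) x ≤ 1 := by
  rw [scaledWeight_neg_one]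
  exact inv_le_one_of_one_le₀ (by nlinarith [sq_nonneg ‖ε • x‖])

/-- The coefficient `∂ᵢ w / w` for `w = (1 + ε²|x|²)^t`. -/
def weightCoeff (ε t : ℝ) (i : Fin 2) (x : Plane) : ℝ :=
  2 * t * ε ^ 2 * x i * scaledWeight ε (-1) x

theorem hasTemperateGrowth_coord (i : Fin 2) : (fun x : Plane => x i).HasTemperateGrowth :=
  (EuclideanSpace.proj i : Plane →L[ℝ] ℝ).hasTemperateGrowth

theorem hasTemperateGrowth_weightCoeff (ε t : ℝ) (i : Fin 2) :
    (weightCoeff ε t i).HasTemperateGrowth :=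
  ((Function.HasTemperateGrowth.const (2 * t * ε ^ 2)).mul (hasTemperateGrowth_coord i)).mul
    (hasTemperateGrowth_scaledWeight ε (-1))

/-- The derivative `∂ᵢ` of `weightCoeff ε t j`. -/
def weightCoeffDeriv (ε t : ℝ) (i j : Fin 2) (x : Plane) : ℝ :=
  2 * t * ε ^ 2 * ((if i = j then 1 else 0) -
    2 * (ε * x i * scaledWeight ε (-1) x) * (ε * x j)) * scaledWeight ε (-1) x

theorem hasTemperateGrowth_weightCoeffDeriv (ε t : ℝ) (i j : Fin 2) :
    (weightCoeffDeriv ε t i j).HasTemperateGrowth := by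
  have h1 := hasTemperateGrowth_coord i
  have h2 := hasTemperateGrowth_coord j
  have h3 := hasTemperateGrowth_scaledWeight ε (-1)
  unfold weightCoeffDeriv
  fun_prop

theorem fderiv_weightCoeff (ε t : ℝ) (i j : Fin 2) (x : Plane) :
    fderiv ℝ (weightCoeff ε t j) x (EuclideanSpace.single i 1) = weightCoeffDeriv ε t i j x := by
  have h1 : HasFDerivAt (fun y : Plane => 2 * t * ε ^ 2 * y j)
      ((2 * t * ε ^ 2) • (EuclideanSpace.proj j : Plane →L[ℝ] ℝ)) x :=
    (EuclideanSpace.proj j : Plane →L[ℝ] ℝ).hasFDerivAt.const_mul _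
  have h2 : DifferentiableAt ℝ (scaledWeight ε (-1)) x :=
    (hasTemperateGrowth_scaledWeight ε (-1)).1.differentiable (by simp) x
  have h3 : fderiv ℝ (weightCoeff ε t j) x = _ := (h1.mul h2.hasFDerivAt).fderiv
  have h4 : (EuclideanSpace.proj j : Plane →L[ℝ] ℝ) (EuclideanSpace.single i 1) =
      if i = j then 1 else 0 := by
    simp [eq_comm]
  rw [h3]
  simp only [add_apply, smul_apply, fderiv_scaledWeight, weightCoeffDeriv, h4, smul_eq_mul]
  ring

theorem abs_weightCoeff_le {ε : ℝ} (hε : 0 < ε) (t : ℝ) (i : Fin 2) (x : Plane) :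
    |weightCoeff ε t i x| ≤ |t| * ε := by
  have e : weightCoeff ε t i x = 2 * t * ε * ((ε * x i) * scaledWeight ε (-1) x) := by
    unfold weightCoeff; ring
  rw [e, abs_mul, abs_mul, abs_mul, abs_mul, abs_of_pos (scaledWeight_pos ε (-1) x),
    abs_of_pos hε, abs_two]
  nlinarith [scaled_coord_le ε i x, mul_nonneg (abs_nonneg t) hε.le]

theorem abs_weightCoeffDeriv_le {ε : ℝ} (hε : 0 < ε) (hε1 : ε ≤ 1) (t : ℝ) (i j : Fin 2)
    (x : Plane) : |weightCoeffDeriv ε t i j x| ≤ 4 * (|t| * ε) := by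
  set w := scaledWeight ε (-1) x with hw
  have hw0 : 0 < w := scaledWeight_pos ε (-1) x
  have hw1 : w ≤ 1 := scaledWeight_neg_one_le_one ε x
  have e : weightCoeffDeriv ε t i j x = 2 * t * ε ^ 2 * ((if i = j then 1 else 0) * w -
    2 * (ε * x i * w) * (ε * x j * w)) := by
    unfold weightCoeffDeriv; ring
  have hi : |ε * x i * w| ≤ 1 / 2 := by
    rw [abs_mul, abs_of_pos hw0]; exact scaled_coord_le ε i x
  have hj : |ε * x j * w| ≤ 1 / 2 := by
    rw [abs_mul, abs_of_pos hw0]; exact scaled_coord_le ε j x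
  have h1 : |(if i = j then 1 else 0) * w - 2 * (ε * x i * w) * (ε * x j * w)| ≤ 2 := by
    have h2 : |(if i = j then 1 else 0) * w| ≤ 1 := by
      split_ifs
      · rw [one_mul, abs_of_pos hw0]; exact hw1
      · simp
    have h3 : |2 * (ε * x i * w) * (ε * x j * w)| ≤ 1 := by
      rw [abs_mul, abs_mul, abs_two]
      nlinarith [abs_nonneg (ε * x i * w), abs_nonneg (ε * x j * w)]
    linarith [abs_sub ((if i = j then 1 else 0) * w) (2 * (ε * x i * w) * (ε * x j * w))]
  have h4 : |2 * t * ε ^ 2| ≤ 2 * (|t| * ε) := by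
    rw [abs_mul, abs_mul, abs_two, abs_of_pos (pow_pos hε 2)]
    nlinarith [mul_nonneg (abs_nonneg t) hε.le]
  rw [e, abs_mul]
  calc _ ≤ 2 * (|t| * ε) * 2 := mul_le_mul h4 h1 (abs_nonneg _) (by positivity)
    _ = _ := by ring

/-- Comparable positive numbers have comparable powers for either sign of the exponent. It makes the
scaled and the unscaled weights interchangeable, at the cost of a constant depending on `ε` and `γ`.
-/
theorem rpow_le_of_le_of_le {p q K : ℝ} (hp : 0 < p) (hpq : p ≤ q) (hK : 1 ≤ K) (hq : q ≤ K * p)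
    (t : ℝ) : p ^ t ≤ K ^ |t| * q ^ t ∧ q ^ t ≤ K ^ |t| * p ^ t := by
  have hq0 : 0 < q := hp.trans_le hpq
  have hK0 : 0 < K := one_pos.trans_le hK
  have h1 : 1 ≤ K ^ |t| := Real.one_le_rpow hK (abs_nonneg t)
  have h2 : (q / p) ^ |t| ≤ K ^ |t| :=
    Real.rpow_le_rpow (by positivity) ((div_le_iff₀ hp).2 hq) (abs_nonneg t)
  rcases le_total 0 t with ht | ht
  · rw [abs_of_nonneg ht] at *
    rw [Real.div_rpow hq0.le hp.le, div_le_iff₀ (by positivity)] at h2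
    refine ⟨?_, h2⟩
    have := Real.rpow_le_rpow hp.le hpq ht
    have : 0 < q ^ t := by positivity
    nlinarith
  · rw [abs_of_nonpos ht] at *
    rw [Real.div_rpow hq0.le hp.le, div_le_iff₀ (by positivity), Real.rpow_neg hq0.le,
      Real.rpow_neg hp.le, ← div_eq_mul_inv, le_div_iff₀ (by positivity),
      inv_mul_le_iff₀ (by positivity)] at h2
    refine ⟨by linarith, ?_⟩
    have := Real.rpow_le_rpow_of_nonpos hp hpq ht
    have : 0 < p ^ t := by positivity
    nlinarith

/-- The weighted `H²` estimate for `Δ - 1`. -/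
theorem exists_weighted_estimate (γ : ℝ) : ∃ C : ℝ, 0 ≤ C ∧ ∀ f : 𝓢(Plane, ℂ),
    ‖schwartzToL2 (schwartzMul (fun x => bracket x ^ γ) f)‖ ≤
        C * ‖schwartzToL2 (schwartzMul (fun x => bracket x ^ γ) (helmholtz f))‖ ∧
      (∀ i, ‖schwartzToL2 (schwartzMul (fun x => bracket x ^ γ) (schwartzDeriv i f))‖ ≤
        C * ‖schwartzToL2 (schwartzMul (fun x => bracket x ^ γ) (helmholtz f))‖) ∧
      ∀ i j, ‖schwartzToL2 (schwartzMul (fun x => bracket x ^ γ)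
          (schwartzDeriv i (schwartzDeriv j f)))‖ ≤
        C * ‖schwartzToL2 (schwartzMul (fun x => bracket x ^ γ) (helmholtz f))‖ := by
  set t := γ / 2 with ht
  -- Chosen so that `4|t|ε ≤ 1/16`, the smallness required of both the coefficients and their
  -- derivatives; the `+ 1` covers `t = 0`.
  set ε : ℝ := 1 / (64 * (|t| + 1)) with hε
  have hε0 : 0 < ε := by positivity
  have hε1 : ε ≤ 1 := by
    rw [hε, div_le_one (by positivity)]
    linarith [abs_nonneg t]
  have htε : 4 * (|t| * ε) ≤ 1 / 16 := by
    rw [hε, mul_one_div, ← mul_div_assoc, div_le_div_iff₀ (by positivity) (by positivity)]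
    linarith [abs_nonneg t]
  have htε0 : 0 ≤ |t| * ε := by positivity
  have hw := hasTemperateGrowth_scaledWeight ε t
  have hb := hasTemperateGrowth_bracket_rpow γ
  -- For `ε ≤ 1`, `1 + ε²|x|² ≤ 1 + |x|² ≤ ε⁻²(1 + ε²|x|²)`; raise to the power `t`.
  set K : ℝ := (ε⁻¹ ^ 2) ^ |t| with hKdef
  have hK : 0 ≤ K := by positivity
  have hcmp : ∀ x : Plane, scaledWeight ε t x ≤ K * bracket x ^ γ ∧
      bracket x ^ γ ≤ K * scaledWeight ε t x := by
    intro x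
    rw [bracket_rpow, scaledWeight]
    have e : ‖ε • x‖ ^ 2 = ε ^ 2 * ‖x‖ ^ 2 := by
      rw [norm_smul, mul_pow, Real.norm_eq_abs, sq_abs]
    have h1 : ε ^ 2 ≤ 1 := pow_le_one₀ hε0.le hε1
    have hx := sq_nonneg ‖x‖
    refine rpow_le_of_le_of_le (by positivity) ?_ (one_le_pow₀ (one_le_inv₀ hε0 |>.2 hε1)) ?_ t
    · rw [e]; nlinarith
    · rw [e, inv_pow, inv_mul_eq_div, le_div_iff₀ (by positivity)]; nlinarith
  have hub : ∀ g, ‖schwartzToL2 (schwartzMul (fun x => bracket x ^ γ) g)‖ ≤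
      K * ‖schwartzToL2 (schwartzMul (scaledWeight ε t) g)‖ := fun g =>
    norm_schwartzMul_le hb hw (fun x => by
      rw [abs_of_pos (scaledWeight_pos _ _ _), abs_of_pos (Real.rpow_pos_of_pos (bracket_pos x) _)]
      exact (hcmp x).2) g
  have hlb : ∀ g, ‖schwartzToL2 (schwartzMul (scaledWeight ε t) g)‖ ≤
      K * ‖schwartzToL2 (schwartzMul (fun x => bracket x ^ γ) g)‖ := fun g =>
    norm_schwartzMul_le hw hb (fun x => by
      rw [abs_of_pos (scaledWeight_pos _ _ _), abs_of_pos (Real.rpow_pos_of_pos (bracket_pos x) _)]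
      exact (hcmp x).1) g
  refine ⟨K * (4 * K), by positivity, fun f => ?_⟩
  obtain ⟨c0, c1, c2⟩ := conjugated_estimate (W := schwartzMul (scaledWeight ε t))
    (A := fun i => schwartzMul (weightCoeff ε t i))
    (B := fun i j => schwartzMul (weightCoeffDeriv ε t i j))
    (fun i g => by
      have hg : (weightCoeff ε t i * scaledWeight ε t).HasTemperateGrowth :=
        (hasTemperateGrowth_weightCoeff ε t i).mul hw
      rw [schwartzDeriv_schwartzMul hw hg i (fun x => fderiv_scaledWeight ε t i x)]
      congr 1
      ext x
      simp only [schwartzMul_apply hg, schwartzMul_apply hw,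
        schwartzMul_apply (hasTemperateGrowth_weightCoeff ε t i), Pi.mul_apply]
      push_cast
      ring)
    (fun i g => norm_schwartzMul_le_of_bound (hasTemperateGrowth_weightCoeff ε t i)
      (fun x => (abs_weightCoeff_le hε0 t i x).trans (by linarith)) g)
    (fun i j g => schwartzDeriv_schwartzMul (hasTemperateGrowth_weightCoeff ε t j)
      (hasTemperateGrowth_weightCoeffDeriv ε t i j) i (fun x => fderiv_weightCoeff ε t i j x) g)
    (fun i j g => norm_schwartzMul_le_of_bound (hasTemperateGrowth_weightCoeffDeriv ε t i j)
      (fun x => (abs_weightCoeffDeriv_le hε0 hε1 t i j x).trans htε) g) f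
  have hH := hlb (helmholtz f)
  have key : ∀ g, ‖schwartzToL2 (schwartzMul (scaledWeight ε t) g)‖ ≤
      4 * ‖schwartzToL2 (schwartzMul (scaledWeight ε t) (helmholtz f))‖ →
      ‖schwartzToL2 (schwartzMul (fun x => bracket x ^ γ) g)‖ ≤ K * (4 * K) *
        ‖schwartzToL2 (schwartzMul (fun x => bracket x ^ γ) (helmholtz f))‖ := fun g hg =>
    calc _ ≤ _ := hub g
      _ ≤ K * (4 * (K * ‖schwartzToL2 (schwartzMul (fun x => bracket x ^ γ) (helmholtz f))‖)) :=
        mul_le_mul_of_nonneg_left (hg.trans (by linarith)) hK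
      _ = _ := by ring
  exact ⟨key _ c0, fun i => key _ (c1 i), fun i j => key _ (c2 i j)⟩

/-! ### Bijectivity on the Schwartz space. -/

open Filter Topology

theorem helmholtz_eq_laplacian (f : 𝓢(Plane, ℂ)) : helmholtz f = Δ f - f := by
  rw [helmholtz_apply, laplacian_eq_sum (EuclideanSpace.basisFun (Fin 2) ℝ), Fin.sum_univ_two]
  simp [schwartzDeriv]

theorem helmholtz_injective : Function.Injective helmholtz := by
  rw [injective_iff_map_eq_zero]
  intro f hf
  have h := norm_le_norm_helmholtz f
  rw [hf, map_zero, norm_zero] at h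
  refine injective_toLp 2 (volume : Measure Plane) ?_
  have h0 : schwartzToL2 f = 0 := norm_le_zero_iff.1 h
  have h1 : schwartzToL2 (0 : 𝓢(Plane, ℂ)) = 0 := map_zero _
  exact h0.trans h1.symm

theorem helmholtz_surjective : Function.Surjective helmholtz := by
  intro f
  -- In the `2π` normalisation of the Fourier transform the symbol of `1 - Δ` is `1 + |2πξ|²`, and
  -- its reciprocal is the scaled weight with `ε = 2π` and exponent `-1`. Being smooth of temperate
  -- growth, it acts on Schwartz functions.
  set w := scaledWeight (2 * Real.pi) (-1) with hw
  have hwt : w.HasTemperateGrowth := hasTemperateGrowth_scaledWeight _ _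
  have hnt : (fun x : Plane => ‖x‖ ^ 2).HasTemperateGrowth :=
    Function.hasTemperateGrowth_norm_sq Plane
  set g := fourierMultiplierCLM ℂ w f with hg
  have hlap : Δ g =
      -(2 * Real.pi) ^ 2 • fourierMultiplierCLM ℂ ((fun x : Plane => ‖x‖ ^ 2) * w) f := by
    rw [laplacian_eq_fourierMultiplierCLM, hg]
    congr 1
    exact fourierMultiplierCLM_fourierMultiplierCLM_apply hnt hwt f
  refine ⟨-g, ?_⟩
  rw [map_neg, helmholtz_eq_laplacian, hlap, hg]
  have hprod : ((fun x : Plane => ‖x‖ ^ 2) * w).HasTemperateGrowth := hnt.mul hwt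
  have h1 : fourierMultiplierCLM ℂ ((2 * Real.pi) ^ 2 • ((fun x : Plane => ‖x‖ ^ 2) * w)) f =
      (2 * Real.pi) ^ 2 • fourierMultiplierCLM ℂ ((fun x : Plane => ‖x‖ ^ 2) * w) f := by
    rw [fourierMultiplierCLM_smul hprod]
    rfl
  have h2 : w = (fun _ => 1) - (2 * Real.pi) ^ 2 • ((fun x : Plane => ‖x‖ ^ 2) * w) := by
    funext x
    have : (0 : ℝ) < 1 + (2 * Real.pi) ^ 2 * ‖x‖ ^ 2 := by positivity
    have e : w x = (1 + (2 * Real.pi) ^ 2 * ‖x‖ ^ 2)⁻¹ := by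
      rw [hw, scaledWeight_neg_one, norm_smul, mul_pow, Real.norm_eq_abs, sq_abs]
    simp only [Pi.sub_apply, Pi.smul_apply, Pi.mul_apply, smul_eq_mul, e]
    field_simp
    ring
  have h3 : fourierMultiplierCLM ℂ w f =
      f - (2 * Real.pi) ^ 2 • fourierMultiplierCLM ℂ ((fun x : Plane => ‖x‖ ^ 2) * w) f := by
    rw [← h1]
    nth_rw 1 [h2]
    have hsub : fourierMultiplierCLM ℂ ((fun _ => 1) -
        (2 * Real.pi) ^ 2 • ((fun x : Plane => ‖x‖ ^ 2) * w)) =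
        fourierMultiplierCLM ℂ (fun _ : Plane => (1 : ℝ)) -
          fourierMultiplierCLM ℂ ((2 * Real.pi) ^ 2 • ((fun x : Plane => ‖x‖ ^ 2) * w)) := by
      ext1 k
      simp only [fourierMultiplierCLM_apply, _root_.sub_apply]
      have hsm : ((2 * Real.pi) ^ 2 • ((fun x : Plane => ‖x‖ ^ 2) * w)).HasTemperateGrowth :=
        (Function.HasTemperateGrowth.const ((2 * Real.pi) ^ 2)).mul hprod
      rw [smulLeftCLM_sub (.const 1) hsm]
      exact map_sub (FourierTransform.fourierInvCLM ℂ 𝓢(Plane, ℂ)) _ _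
    rw [hsub, fourierMultiplierCLM_const]
    simp
  rw [h3]
  module

/-- The operator `Δ - 1` is an automorphism of the Schwartz space. -/
def helmholtzEquiv : 𝓢(Plane, ℂ) ≃ₗ[ℂ] 𝓢(Plane, ℂ) :=
  LinearEquiv.ofBijective (helmholtz : 𝓢(Plane, ℂ) →ₗ[ℂ] 𝓢(Plane, ℂ))
    ⟨helmholtz_injective, helmholtz_surjective⟩

theorem helmholtzEquiv_apply (f : 𝓢(Plane, ℂ)) : helmholtzEquiv f = helmholtz f :=
  rfl

/-! ### Derivatives of all orders and two-sided jet estimates. -/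

/-- The operator `D^α` on Schwartz functions. -/
def schwartzMultiDeriv (α : ℕ × ℕ) : 𝓢(Plane, ℂ) →L[ℂ] 𝓢(Plane, ℂ) :=
  schwartzDeriv 0 ^ α.1 * schwartzDeriv 1 ^ α.2

theorem coe_schwartzDeriv_pow (i : Fin 2) (k : ℕ) (f : 𝓢(Plane, ℂ)) :
    (((schwartzDeriv i) ^ k) f : Plane → ℂ) = (pderiv i)^[k] f := by
  induction k with
  | zero => rfl
  | succ k ih =>
    rw [Function.iterate_succ_apply', ← ih, pow_succ', ← coe_schwartzDeriv]
    rfl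

theorem coe_schwartzMultiDeriv (α : ℕ × ℕ) (f : 𝓢(Plane, ℂ)) :
    (schwartzMultiDeriv α f : Plane → ℂ) = multiDeriv α f := by
  rw [multiDeriv, ← coe_schwartzDeriv_pow, ← coe_schwartzDeriv_pow]
  rfl

theorem commute_schwartzDeriv (i j : Fin 2) : Commute (schwartzDeriv i) (schwartzDeriv j) :=
  ContinuousLinearMap.ext fun f => schwartzDeriv_comm i j f

theorem helmholtz_eq_mul :
    helmholtz = schwartzDeriv 0 * schwartzDeriv 0 + schwartzDeriv 1 * schwartzDeriv 1 - 1 :=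
  rfl

theorem commute_helmholtz_schwartzDeriv (i : Fin 2) : Commute helmholtz (schwartzDeriv i) := by
  rw [helmholtz_eq_mul]
  exact (((commute_schwartzDeriv _ _).mul_left (commute_schwartzDeriv _ _)).add_left
    ((commute_schwartzDeriv _ _).mul_left (commute_schwartzDeriv _ _))).sub_left
      (Commute.one_left _)

theorem helmholtz_schwartzMultiDeriv (α : ℕ × ℕ) (f : 𝓢(Plane, ℂ)) :
    helmholtz (schwartzMultiDeriv α f) = schwartzMultiDeriv α (helmholtz f) := by
  have h : Commute helmholtz (schwartzMultiDeriv α) :=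
    ((commute_helmholtz_schwartzDeriv 0).pow_right _).mul_right
      ((commute_helmholtz_schwartzDeriv 1).pow_right _)
  exact congrArg (fun A : 𝓢(Plane, ℂ) →L[ℂ] 𝓢(Plane, ℂ) => A f) h.eq

theorem schwartzDeriv_zero_schwartzMultiDeriv (a b : ℕ) :
    schwartzDeriv 0 * schwartzMultiDeriv (a, b) = schwartzMultiDeriv (a + 1, b) := by
  simp [schwartzMultiDeriv, pow_succ', mul_assoc]

theorem schwartzDeriv_one_schwartzMultiDeriv (a b : ℕ) :
    schwartzDeriv 1 * schwartzMultiDeriv (a, b) = schwartzMultiDeriv (a, b + 1) := by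
  have h := ((commute_schwartzDeriv 1 0).pow_right a).eq
  simp only [schwartzMultiDeriv, pow_succ', ← mul_assoc, h]

/-- A derivative of order at most `s + 2` is one of order at most `2` of one of order at most
`s`. -/
theorem schwartzMultiDeriv_decompose {s : ℕ} {β : ℕ × ℕ} (hβ : β.1 + β.2 ≤ s + 2) :
    ∃ α : MultiIndex s, schwartzMultiDeriv β = schwartzMultiDeriv α.1 ∨
      (∃ i, schwartzMultiDeriv β = schwartzDeriv i * schwartzMultiDeriv α.1) ∨
      ∃ i j, schwartzMultiDeriv β = schwartzDeriv i * (schwartzDeriv j *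
        schwartzMultiDeriv α.1) := by
  obtain ⟨a, b⟩ := β
  simp only at hβ
  by_cases h0 : a + b ≤ s
  · exact ⟨⟨(a, b), h0⟩, Or.inl rfl⟩
  by_cases h1 : a + b ≤ s + 1
  · rcases a with _ | a
    · rcases b with _ | b
      · omega
      · exact ⟨⟨(0, b), by simp; omega⟩, Or.inr (Or.inl
          ⟨1, (schwartzDeriv_one_schwartzMultiDeriv _ _).symm⟩)⟩
    · exact ⟨⟨(a, b), by simp; omega⟩, Or.inr (Or.inl
        ⟨0, (schwartzDeriv_zero_schwartzMultiDeriv _ _).symm⟩)⟩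
  rcases a with _ | _ | a
  · rcases b with _ | _ | b
    · omega
    · omega
    · exact ⟨⟨(0, b), by simp; omega⟩, Or.inr (Or.inr ⟨1, 1, by
        simp only [schwartzDeriv_one_schwartzMultiDeriv]⟩)⟩
  · rcases b with _ | b
    · omega
    · exact ⟨⟨(0, b), by simp; omega⟩, Or.inr (Or.inr ⟨0, 1, by
        simp only [schwartzDeriv_one_schwartzMultiDeriv,
          schwartzDeriv_zero_schwartzMultiDeriv]⟩)⟩
  · exact ⟨⟨(a, b), by simp; omega⟩, Or.inr (Or.inr ⟨0, 0, by
      simp only [schwartzDeriv_zero_schwartzMultiDeriv]⟩)⟩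

/-- The map `f ↦ ⟨x⟩^γ D^α f` from Schwartz functions to `L²`. -/
def weightedDeriv (γ : ℝ) (α : ℕ × ℕ) : 𝓢(Plane, ℂ) →L[ℂ] Lp ℂ 2 (volume : Measure Plane) :=
  schwartzToL2 ∘L schwartzMul (fun x => bracket x ^ γ) ∘L schwartzMultiDeriv α

theorem weightedDeriv_apply (γ : ℝ) (α : ℕ × ℕ) (f : 𝓢(Plane, ℂ)) :
    weightedDeriv γ α f =
      schwartzToL2 (schwartzMul (fun x => bracket x ^ γ) (schwartzMultiDeriv α f)) :=
  rfl

theorem coeFn_weightedDeriv (γ : ℝ) (α : ℕ × ℕ) (f : 𝓢(Plane, ℂ)) :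
    weightedDeriv γ α f =ᵐ[volume] fun x => ((bracket x ^ γ : ℝ) : ℂ) * multiDeriv α f x := by
  refine (coeFn_toLp _ 2 volume).trans (Eventually.of_forall fun x => ?_)
  change schwartzMul _ (schwartzMultiDeriv α f) x = _
  rw [schwartzMul_apply (hasTemperateGrowth_bracket_rpow γ), coe_schwartzMultiDeriv]

/-- The weighted jet of a Schwartz function. -/
def schwartzJet (s : ℕ) (γ : ℝ) : 𝓢(Plane, ℂ) →ₗ[ℂ] JetSpace s :=
  (WithLp.linearEquiv 1 ℂ (MultiIndex s → Lp ℂ 2 (volume : Measure Plane))).symm ∘ₗ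
    LinearMap.pi fun α : MultiIndex s => (weightedDeriv γ α.1).toLinearMap

theorem schwartzJet_apply (s : ℕ) (γ : ℝ) (f : 𝓢(Plane, ℂ)) (α : MultiIndex s) :
    schwartzJet s γ f α = weightedDeriv γ α.1 f :=
  rfl

theorem isWeightedJet_schwartzJet (s : ℕ) (γ : ℝ) (f : 𝓢(Plane, ℂ)) :
    IsWeightedJet s γ f (schwartzJet s γ f) :=
  fun α => coeFn_weightedDeriv γ α.1 f

theorem norm_jet_eq {s : ℕ} (v : JetSpace s) : ‖v‖ = ∑ α, ‖v α‖ := by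
  rw [PiLp.norm_eq_sum (by norm_num)]
  simp

theorem norm_jet_le_of_forall {s : ℕ} (v : JetSpace s) {c : ℝ} (h : ∀ α, ‖v α‖ ≤ c) :
    ‖v‖ ≤ Fintype.card (MultiIndex s) * c := by
  rw [norm_jet_eq]
  simpa using Finset.sum_le_card_nsmul Finset.univ (fun α => ‖v α‖) c (fun α _ => h α)

theorem norm_schwartzJet_helmholtz_le (s : ℕ) (γ : ℝ) : ∃ C : ℝ, ∀ f : 𝓢(Plane, ℂ),
    ‖schwartzJet s γ (helmholtz f)‖ ≤ C * ‖schwartzJet (s + 2) γ f‖ := by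
  refine ⟨Fintype.card (MultiIndex s) * 3, fun f => ?_⟩
  rw [mul_assoc]
  refine norm_jet_le_of_forall _ fun α => ?_
  have hα := α.2
  have hle : ∀ (a b : ℕ), a + b ≤ s + 2 →
      ‖weightedDeriv γ (a, b) f‖ ≤ ‖schwartzJet (s + 2) γ f‖ := fun a b h =>
    PiLp.norm_apply_le (schwartzJet (s + 2) γ f) ⟨(a, b), h⟩
  have e : weightedDeriv γ α.1 (helmholtz f) = weightedDeriv γ (α.1.1 + 2, α.1.2) f +
      weightedDeriv γ (α.1.1, α.1.2 + 2) f - weightedDeriv γ (α.1.1, α.1.2) f := by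
    simp only [weightedDeriv_apply, ← map_add, ← map_sub]
    congr 2
    rw [← helmholtz_schwartzMultiDeriv, helmholtz_apply]
    simp only [← schwartzDeriv_zero_schwartzMultiDeriv, ← schwartzDeriv_one_schwartzMultiDeriv]
    rfl
  rw [schwartzJet_apply, e]
  have h1 := norm_sub_le (weightedDeriv γ (α.1.1 + 2, α.1.2) f +
      weightedDeriv γ (α.1.1, α.1.2 + 2) f) (weightedDeriv γ (α.1.1, α.1.2) f)
  have h2 := norm_add_le (weightedDeriv γ (α.1.1 + 2, α.1.2) f)
      (weightedDeriv γ (α.1.1, α.1.2 + 2) f)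
  linarith [hle (α.1.1 + 2) α.1.2 (by omega), hle α.1.1 (α.1.2 + 2) (by omega),
    hle α.1.1 α.1.2 (by omega)]

/-- Each `D^β` of order at most `s + 2` is at most two derivatives of some `D^α f` with `|α| ≤ s`.
The second-order estimate applied to `D^α f` suffices, because `(Δ - 1)D^α f = D^α(Δ - 1)f`. -/
theorem norm_schwartzJet_le_helmholtz (s : ℕ) (γ : ℝ) : ∃ C : ℝ, ∀ f : 𝓢(Plane, ℂ),
    ‖schwartzJet (s + 2) γ f‖ ≤ C * ‖schwartzJet s γ (helmholtz f)‖ := by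
  obtain ⟨C, hC, h⟩ := exists_weighted_estimate γ
  refine ⟨Fintype.card (MultiIndex (s + 2)) * C, fun f => ?_⟩
  rw [mul_assoc]
  refine norm_jet_le_of_forall _ fun β => ?_
  obtain ⟨α, hα⟩ := schwartzMultiDeriv_decompose β.2
  obtain ⟨h0, h1, h2⟩ := h (schwartzMultiDeriv α.1 f)
  rw [helmholtz_schwartzMultiDeriv] at h0 h1 h2
  have hle : ‖weightedDeriv γ α.1 (helmholtz f)‖ ≤ ‖schwartzJet s γ (helmholtz f)‖ :=
    PiLp.norm_apply_le (schwartzJet s γ (helmholtz f)) α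
  refine le_trans ?_ (mul_le_mul_of_nonneg_left hle hC)
  rw [schwartzJet_apply, weightedDeriv_apply, weightedDeriv_apply]
  rcases hα with hα | ⟨i, hα⟩ | ⟨i, j, hα⟩ <;> rw [hα]
  · exact h0
  · exact h1 i
  · exact h2 i j

/-! ### Cutoffs and density of Schwartz functions. -/

/-- The dilated cutoff `x ↦ χ(x / (k + 1))`. -/
def dilate (χ : Plane → ℝ) (k : ℕ) (x : Plane) : ℝ := χ (((k : ℝ) + 1)⁻¹ • x)

theorem hasCompactSupport_dilate {χ : Plane → ℝ} (h : HasCompactSupport χ) (k : ℕ) :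
    HasCompactSupport (dilate χ k) :=
  have hk : ((k : ℝ) + 1)⁻¹ ≠ 0 := by positivity
  h.comp_homeomorph (Homeomorph.smulOfNeZero (α := Plane) (((k : ℝ) + 1)⁻¹) hk)

theorem contDiff_dilate {χ : Plane → ℝ} (h : ContDiff ℝ ∞ χ) (k : ℕ) :
    ContDiff ℝ ∞ (dilate χ k) :=
  h.comp (contDiff_const_smul _)

theorem hasTemperateGrowth_dilate {χ : Plane → ℝ} (h : ContDiff ℝ ∞ χ)
    (h' : HasCompactSupport χ) (k : ℕ) : (dilate χ k).HasTemperateGrowth :=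
  (hasCompactSupport_dilate h' k).hasTemperateGrowth (contDiff_dilate h k)

/-- A smooth compactly supported `χ` is Lipschitz, so `|χ(x/(k+1)) - χ(0)| ≤ L⟨x⟩/(k+1)`, and the
`L²` error is at most `L/(k+1)` times the norm of `⟨x⟩f`. -/
theorem tendsto_schwartzMul_dilate {χ : Plane → ℝ} (h : ContDiff ℝ ∞ χ)
    (h' : HasCompactSupport χ) (f : 𝓢(Plane, ℂ)) :
    Tendsto (fun k => schwartzToL2 (schwartzMul (dilate χ k) f)) atTop
      (𝓝 ((χ 0 : ℂ) • schwartzToL2 f)) := by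
  obtain ⟨L, hL⟩ := (h.of_le (by simp : (1 : WithTop ℕ∞) ≤ ∞)).lipschitzWith_of_hasCompactSupport
    h' (by simp)
  have hb : (fun x : Plane => bracket x ^ (1 : ℝ)).HasTemperateGrowth :=
    hasTemperateGrowth_bracket_rpow 1
  have hd := hasTemperateGrowth_dilate h h'
  rw [tendsto_iff_norm_sub_tendsto_zero]
  have hlim : Tendsto (fun k : ℕ => (L * ((k : ℝ) + 1)⁻¹) *
      ‖schwartzToL2 (schwartzMul (fun x => bracket x ^ (1 : ℝ)) f)‖) atTop (𝓝 0) := by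
    have := ((tendsto_one_div_add_atTop_nhds_zero_nat (𝕜 := ℝ)).const_mul (L : ℝ)).mul_const
      ‖schwartzToL2 (schwartzMul (fun x => bracket x ^ (1 : ℝ)) f)‖
    simpa using this
  refine squeeze_zero (fun _ => norm_nonneg _) (fun k => ?_) hlim
  have hsub : (fun x => dilate χ k x - χ 0).HasTemperateGrowth := (hd k).sub (.const _)
  have e : schwartzToL2 (schwartzMul (dilate χ k) f) - (χ 0 : ℂ) • schwartzToL2 f =
      schwartzToL2 (schwartzMul (fun x => dilate χ k x - χ 0) f) := by
    rw [← map_smul, ← map_sub]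
    congr 1
    ext x
    simp [schwartzMul_apply (hd k), schwartzMul_apply hsub, sub_mul]
  rw [e]
  refine norm_schwartzMul_le hsub hb (fun x => ?_) f
  have h1 := hL.dist_le_mul (((k : ℝ) + 1)⁻¹ • x) 0
  rw [dist_zero_right, norm_smul, Real.norm_eq_abs, abs_of_pos (by positivity)] at h1
  have h2 : ‖x‖ ≤ bracket x := Real.le_sqrt_of_sq_le (by linarith)
  rw [Real.rpow_one, abs_of_pos (bracket_pos x), mul_assoc]
  refine h1.trans ?_
  gcongr

/-- Convergence of cutoffs, in `L²`, after application of the operator `A`. -/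
def CutoffTendsto (A : 𝓢(Plane, ℂ) →L[ℂ] 𝓢(Plane, ℂ)) : Prop :=
  ∀ χ : Plane → ℝ, ContDiff ℝ ∞ χ → HasCompactSupport χ → ∀ f : 𝓢(Plane, ℂ),
    Tendsto (fun k => schwartzToL2 (A (schwartzMul (dilate χ k) f))) atTop
      (𝓝 ((χ 0 : ℂ) • schwartzToL2 (A f)))

theorem cutoffTendsto_schwartzMul {g : Plane → ℝ} (hg : g.HasTemperateGrowth) :
    CutoffTendsto (schwartzMul g) := by
  intro χ h h' f
  have e : ∀ k, schwartzMul g (schwartzMul (dilate χ k) f) =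
      schwartzMul (dilate χ k) (schwartzMul g f) := fun k => by
    ext x
    simp only [schwartzMul_apply hg, schwartzMul_apply (hasTemperateGrowth_dilate h h' k)]
    ring
  simpa only [e] using tendsto_schwartzMul_dilate h h' (schwartzMul g f)

/-- The product rule produces the dilated cutoff of `∂ᵢχ` with a factor `1/(k+1)`, which kills its
limit. The induction needs convergence for this second cutoff too, which is why `CutoffTendsto`
quantifies over all `χ` and does not assume `χ(0) = 1`. -/
theorem CutoffTendsto.comp_schwartzDeriv {A : 𝓢(Plane, ℂ) →L[ℂ] 𝓢(Plane, ℂ)}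
    (hA : CutoffTendsto A) (i : Fin 2) : CutoffTendsto (A * schwartzDeriv i) := by
  intro χ h h' f
  set χ' : Plane → ℝ := fun x => fderiv ℝ χ x (EuclideanSpace.single i 1) with hχ'
  have hs : ContDiff ℝ ∞ χ' := (h.fderiv_right (by simp)).clm_apply contDiff_const
  have hs' : HasCompactSupport χ' :=
    (h'.fderiv (𝕜 := ℝ)).comp_left (g := fun L : Plane →L[ℝ] ℝ => L (EuclideanSpace.single i 1))
      (by simp)
  have hd := hasTemperateGrowth_dilate h h'
  have hd' := hasTemperateGrowth_dilate hs hs'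
  have hc : ∀ k : ℕ, (fun x => ((k : ℝ) + 1)⁻¹ * dilate χ' k x).HasTemperateGrowth := fun k =>
    (Function.HasTemperateGrowth.const _).mul (hd' k)
  have hder : ∀ (k : ℕ) (x : Plane), fderiv ℝ (dilate χ k) x (EuclideanSpace.single i 1) =
      ((k : ℝ) + 1)⁻¹ * dilate χ' k x := fun k x => by
    have h1 : HasFDerivAt χ (fderiv ℝ χ (((k : ℝ) + 1)⁻¹ • x)) (((k : ℝ) + 1)⁻¹ • x) :=
      (h.differentiable (by simp) _).hasFDerivAt
    have h2 : HasFDerivAt (fun y : Plane => ((k : ℝ) + 1)⁻¹ • y)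
        (((k : ℝ) + 1)⁻¹ • ContinuousLinearMap.id ℝ Plane) x :=
      (((k : ℝ) + 1)⁻¹ • ContinuousLinearMap.id ℝ Plane).hasFDerivAt
    have h3 : fderiv ℝ (dilate χ k) x = _ := (h1.comp x h2).fderiv
    rw [h3]
    simp [dilate, hχ']
  have e : ∀ k, schwartzToL2 ((A * schwartzDeriv i) (schwartzMul (dilate χ k) f)) =
      schwartzToL2 (A (schwartzMul (dilate χ k) (schwartzDeriv i f))) +
        ((((k : ℝ) + 1)⁻¹ : ℝ) : ℂ) • schwartzToL2 (A (schwartzMul (dilate χ' k) f)) := by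
    intro k
    rw [← map_smul, ← map_smul, ← map_add, ← map_add]
    change schwartzToL2 (A (schwartzDeriv i _)) = _
    rw [schwartzDeriv_schwartzMul (hd k) (hc k) i (hder k)]
    congr 3
    ext x
    simp [schwartzMul_apply (hc k), schwartzMul_apply (hd' k), mul_assoc]
  simp only [e]
  have hz : Tendsto (fun k : ℕ => ((((k : ℝ) + 1)⁻¹ : ℝ) : ℂ)) atTop (𝓝 0) := by
    have h0 := tendsto_one_div_add_atTop_nhds_zero_nat (𝕜 := ℝ)
    simpa [Function.comp_def] using (Complex.continuous_ofReal.tendsto 0).comp h0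
  simpa using (hA χ h h' (schwartzDeriv i f)).add (hz.smul (hA χ' hs hs' f))

theorem CutoffTendsto.comp_schwartzDeriv_pow {A : 𝓢(Plane, ℂ) →L[ℂ] 𝓢(Plane, ℂ)}
    (hA : CutoffTendsto A) (i : Fin 2) (k : ℕ) : CutoffTendsto (A * schwartzDeriv i ^ k) := by
  induction k with
  | zero => simpa using hA
  | succ k ih =>
    rw [pow_succ, ← mul_assoc]
    exact ih.comp_schwartzDeriv i

theorem tendsto_weightedDeriv_cutoff {χ : Plane → ℝ} (h : ContDiff ℝ ∞ χ)
    (h' : HasCompactSupport χ) (h0 : χ 0 = 1) (γ : ℝ) (α : ℕ × ℕ) (f : 𝓢(Plane, ℂ)) :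
    Tendsto (fun k => weightedDeriv γ α (schwartzMul (dilate χ k) f)) atTop
      (𝓝 (weightedDeriv γ α f)) := by
  have h1 := ((cutoffTendsto_schwartzMul
    (hasTemperateGrowth_bracket_rpow γ)).comp_schwartzDeriv_pow 0 α.1).comp_schwartzDeriv_pow 1 α.2
  rw [mul_assoc] at h1
  have h2 := h1 χ h h' f
  rw [h0, Complex.ofReal_one, one_smul] at h2
  exact h2

theorem tendsto_schwartzJet_cutoff {χ : Plane → ℝ} (h : ContDiff ℝ ∞ χ)
    (h' : HasCompactSupport χ) (h0 : χ 0 = 1) (s : ℕ) (γ : ℝ) (f : 𝓢(Plane, ℂ)) :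
    Tendsto (fun k => schwartzJet s γ (schwartzMul (dilate χ k) f)) atTop
      (𝓝 (schwartzJet s γ f)) := by
  have h1 : Tendsto (fun k => WithLp.ofLp (schwartzJet s γ (schwartzMul (dilate χ k) f))) atTop
      (𝓝 (WithLp.ofLp (schwartzJet s γ f))) :=
    tendsto_pi_nhds.2 fun α => tendsto_weightedDeriv_cutoff h h' h0 γ α.1 f
  exact ((PiLp.continuous_toLp 1 _).tendsto _).comp h1

theorem isTest_schwartzMul {χ : Plane → ℝ} (h : ContDiff ℝ ∞ χ) (h' : HasCompactSupport χ)
    (f : 𝓢(Plane, ℂ)) : IsTest (schwartzMul χ f) := by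
  refine ⟨(schwartzMul χ f).smooth ⊤, ?_⟩
  have e : (schwartzMul χ f : Plane → ℂ) = (fun x => (χ x : ℂ)) * f := by
    ext x
    exact schwartzMul_apply (h'.hasTemperateGrowth h) f x
  rw [e]
  exact HasCompactSupport.mul_right (h'.comp_left (g := ((↑) : ℝ → ℂ)) (by simp))

theorem schwartzJet_mem_sobolev (s : ℕ) (γ : ℝ) (f : 𝓢(Plane, ℂ)) :
    schwartzJet s γ f ∈ Sobolev s γ := by
  let χ : ContDiffBump (0 : Plane) := ⟨1, 2, one_pos, one_lt_two⟩
  have hχ : ContDiff ℝ ∞ χ := χ.contDiff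
  refine mem_closure_of_tendsto
    (tendsto_schwartzJet_cutoff hχ χ.hasCompactSupport (χ.one_of_mem_closedBall (by simp [χ])) s γ f)
    (Eventually.of_forall fun k => ?_)
  exact ⟨_, isTest_schwartzMul (contDiff_dilate hχ k)
    (hasCompactSupport_dilate χ.hasCompactSupport k) f, isWeightedJet_schwartzJet s γ _⟩

/-- Schwartz functions as elements of `H^s_γ`. -/
def schwartzToSobolev (s : ℕ) (γ : ℝ) : 𝓢(Plane, ℂ) →ₗ[ℂ] Sobolev s γ :=
  (schwartzJet s γ).codRestrict (Sobolev s γ) (schwartzJet_mem_sobolev s γ)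

theorem IsTest.exists_schwartz {φ : Plane → ℂ} (h : IsTest φ) :
    ∃ f : 𝓢(Plane, ℂ), (f : Plane → ℂ) = φ :=
  ⟨h.2.toSchwartzMap h.1, rfl⟩

theorem denseRange_schwartzToSobolev (s : ℕ) (γ : ℝ) : DenseRange (schwartzToSobolev s γ) := by
  intro u
  rw [closure_subtype]
  refine closure_mono ?_ u.2
  rintro v ⟨φ, hφ, hv⟩
  obtain ⟨f, rfl⟩ := hφ.exists_schwartz
  refine ⟨_, ⟨f, rfl⟩, ?_⟩
  change schwartzJet s γ f = v
  ext1 α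
  exact Lp.ext ((isWeightedJet_schwartzJet s γ f α).trans (hv α).symm)

/-! ### Extension to the Sobolev spaces and the distributional equation. -/

instance (s : ℕ) (γ : ℝ) : CompleteSpace (Sobolev s γ) :=
  (testJets s γ).isClosed_topologicalClosure.completeSpace_coe

/-- The operator `Δ - 1` from `H^{s+2}_γ` to `H^s_γ`. -/
def sobolevHelmholtz (s : ℕ) (γ : ℝ) : Sobolev (s + 2) γ ≃L[ℂ] Sobolev s γ :=
  helmholtzEquiv.extend (schwartzToSobolev (s + 2) γ) (schwartzToSobolev s γ)
    (denseRange_schwartzToSobolev _ _) (norm_schwartzJet_helmholtz_le s γ)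
    (denseRange_schwartzToSobolev _ _) (by
      obtain ⟨C, hC⟩ := norm_schwartzJet_le_helmholtz s γ
      refine ⟨C, fun f => ?_⟩
      have h := hC (helmholtzEquiv.symm f)
      rwa [← helmholtzEquiv_apply, LinearEquiv.apply_symm_apply] at h)

theorem sobolevHelmholtz_schwartz (s : ℕ) (γ : ℝ) (f : 𝓢(Plane, ℂ)) :
    sobolevHelmholtz s γ (schwartzToSobolev (s + 2) γ f) = schwartzToSobolev s γ (helmholtz f) :=
  LinearEquiv.extend_eq ..

theorem bracket_rpow_neg_mul (γ : ℝ) (x : Plane) :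
    ((bracket x ^ (-γ) : ℝ) : ℂ) * ((bracket x ^ γ : ℝ) : ℂ) = 1 := by
  rw [← Complex.ofReal_mul, ← Real.rpow_add (bracket_pos x)]
  simp

theorem toFun_schwartzToSobolev (s : ℕ) (γ : ℝ) (f : 𝓢(Plane, ℂ)) :
    toFun (schwartzToSobolev s γ f) =ᵐ[volume] f := by
  filter_upwards [isWeightedJet_schwartzJet s γ f ⟨(0, 0), Nat.zero_le s⟩] with x hx
  change _ * (schwartzJet s γ f) _ x = _
  rw [hx, ← mul_assoc, bracket_rpow_neg_mul, one_mul]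
  rfl

/-- The pairing of an element of `H^s_γ` with a Schwartz function. -/
def pairingCLM {s : ℕ} {γ : ℝ} (f : 𝓢(Plane, ℂ)) : Sobolev s γ →L[ℂ] ℂ :=
  -- The inner product conjugates its first entry, so `star` makes the pairing bilinear; the weight
  -- `⟨x⟩^(-γ)` of `toFun` is carried by the test function.
  (innerSL ℂ (star (schwartzToL2 (schwartzMul (fun x => bracket x ^ (-γ)) f)))) ∘L
    (PiLp.proj 1 (fun _ : MultiIndex s => Lp ℂ 2 (volume : Measure Plane))
      ⟨(0, 0), Nat.zero_le s⟩) ∘L (Sobolev s γ).subtypeL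

theorem pairingCLM_apply {s : ℕ} {γ : ℝ} (f : 𝓢(Plane, ℂ)) (u : Sobolev s γ) :
    pairingCLM f u = ∫ x, toFun u x * f x := by
  change inner ℂ (star (schwartzToL2 _)) ((u : JetSpace s) _) = _
  rw [L2.inner_def]
  refine integral_congr_ae ?_
  filter_upwards [Lp.coeFn_star (schwartzToL2 (schwartzMul (fun x => bracket x ^ (-γ)) f)),
    coeFn_toLp (schwartzMul (fun x => bracket x ^ (-γ)) f) 2 volume] with x h1 h2
  rw [h1, Pi.star_apply]
  simp only [schwartzToL2, toLpCLM_apply]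
  rw [h2, schwartzMul_apply (hasTemperateGrowth_bracket_rpow (-γ)), toFun]
  simp
  ring

theorem integral_helmholtz_mul (f g : 𝓢(Plane, ℂ)) :
    ∫ x, helmholtz f x * g x = ∫ x, f x * helmholtz g x := by
  have h := integral_mul_laplacian_right_eq_left (μ := (volume : Measure Plane)) f g
  have i1 : Integrable fun x => f x * g x :=
    (pairing (ContinuousLinearMap.mul ℂ ℂ) f g).integrable
  have i2 : Integrable fun x => f x * (Δ g) x :=
    (pairing (ContinuousLinearMap.mul ℂ ℂ) f (Δ g)).integrable
  have i3 : Integrable fun x => (Δ f) x * g x :=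
    (pairing (ContinuousLinearMap.mul ℂ ℂ) (Δ f) g).integrable
  simp only [helmholtz_eq_laplacian, sub_apply, sub_mul, mul_sub]
  rw [integral_sub i3 i1, integral_sub i2 i1, h]

/-- Both sides are continuous in `u` through `pairingCLM`, so it is enough to take `u` Schwartz,
where it is the symmetry of `Δ - 1`. -/
theorem integral_sobolevHelmholtz_mul {s : ℕ} {γ : ℝ} (u : Sobolev (s + 2) γ)
    (f : 𝓢(Plane, ℂ)) :
    ∫ x, toFun (sobolevHelmholtz s γ u) x * f x = ∫ x, toFun u x * helmholtz f x := by
  simp only [← pairingCLM_apply]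
  refine (denseRange_schwartzToSobolev (s + 2) γ).induction_on u
    (isClosed_eq (by fun_prop) (by fun_prop)) fun g => ?_
  rw [sobolevHelmholtz_schwartz, pairingCLM_apply, pairingCLM_apply]
  refine (integral_congr_ae ?_).trans ((integral_helmholtz_mul g f).trans (integral_congr_ae ?_))
  · filter_upwards [toFun_schwartzToSobolev s γ (helmholtz g)] with x hx
    rw [hx]
  · filter_upwards [toFun_schwartzToSobolev (s + 2) γ g] with x hx
    rw [hx]

theorem laplacianSubId_sobolevHelmholtz {s : ℕ} {γ : ℝ} (u : Sobolev (s + 2) γ) :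
    LaplacianSubId (toFun u) (toFun (sobolevHelmholtz s γ u)) := by
  intro φ hφ
  obtain ⟨f, rfl⟩ := hφ.exists_schwartz
  rw [integral_sobolevHelmholtz_mul]
  simp only [helmholtz_eq_laplacian, sub_apply, laplacian_apply]

/-! ### Rotations and mode spaces. -/

/-- The identification of the plane with `ℂ`. -/
def toComplex : Plane ≃ₗᵢ[ℝ] ℂ :=
  Complex.orthonormalBasisOneI.repr.symm

theorem toComplex_apply (x : Plane) : toComplex x = ⟨x 0, x 1⟩ := by
  change Complex.orthonormalBasisOneI.repr.symm x = _
  rw [Complex.orthonormalBasisOneI_repr_symm_apply, Complex.mk_eq_add_mul_I]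

/-- The rotation of the plane by `a`. -/
def planeRotation (a : Circle) : Plane ≃ₗᵢ[ℝ] Plane :=
  (toComplex.trans (rotation a)).trans toComplex.symm

theorem toComplex_planeRotation (a : Circle) (x : Plane) :
    toComplex (planeRotation a x) = a * toComplex x := by
  simp [planeRotation]

theorem planeRotation_mul (a b : Circle) (x : Plane) :
    planeRotation (a * b) x = planeRotation a (planeRotation b x) :=
  toComplex.injective (by simp only [toComplex_planeRotation, Circle.coe_mul, mul_assoc])

/-- The unit complex number with the argument of `x`. -/
def phase (x : Plane) : Circle := Circle.exp (Complex.arg (toComplex x))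

theorem angular_eq (n : ℕ) (x : Plane) : angular n x = (phase x : ℂ) ^ n := by
  rw [angular, phase, Circle.coe_exp, ← Complex.exp_nat_mul, toComplex_apply, mul_assoc]

theorem norm_mul_phase (x : Plane) : (‖x‖ : ℂ) * phase x = toComplex x := by
  rw [phase, Circle.coe_exp, ← toComplex.norm_map x]
  exact Complex.norm_mul_exp_arg_mul_I _

theorem planeRotation_phase (x : Plane) :
    planeRotation (phase x) (toComplex.symm (‖x‖ : ℂ)) = x :=
  toComplex.injective (by
    rw [toComplex_planeRotation, LinearIsometryEquiv.apply_symm_apply, mul_comm, norm_mul_phase])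

theorem phase_planeRotation (a : Circle) {x : Plane} (hx : x ≠ 0) :
    (phase (planeRotation a x) : ℂ) = a * phase x := by
  have h := norm_mul_phase (planeRotation a x)
  have h0 : (‖x‖ : ℂ) ≠ 0 := by simpa using hx
  rw [toComplex_planeRotation, LinearIsometryEquiv.norm_map, ← norm_mul_phase x,
    mul_left_comm] at h
  exact mul_left_cancel₀ h0 h

theorem angular_planeRotation (n : ℕ) (a : Circle) {x : Plane} (hx : x ≠ 0) :
    angular n (planeRotation a x) = (a : ℂ) ^ n * angular n x := by
  rw [angular_eq, angular_eq, phase_planeRotation a hx, mul_pow]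

theorem ae_ne_zero : ∀ᵐ x : Plane, x ≠ 0 :=
  Measure.ae_ne volume 0

theorem continuous_planeRotation : Continuous fun z : Plane × Circle => planeRotation z.2 z.1 := by
  have h : Continuous fun z : Plane × Circle => toComplex.symm ((z.2 : ℂ) * toComplex z.1) := by
    fun_prop
  exact h

theorem measurePreserving_planeRotation (a : Circle) :
    MeasurePreserving (planeRotation a) (volume : Measure Plane) volume :=
  (planeRotation a).measurePreserving

/-- A function transforming by `aⁿ` under the rotation by `a`, for each `a`, has the form
`p(r) e^{inθ}`. -/
theorem exists_profile_of_rotation {g : Plane → ℂ} (hg : Measurable g) (n : ℕ)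
    (h : ∀ a : Circle, ∀ᵐ x, g (planeRotation a x) = (a : ℂ) ^ n * g x) :
    ∃ p : ℝ → ℂ, g =ᵐ[volume] fun x => p ‖x‖ * angular n x := by
  let _ : MeasurableSpace Circle := borel Circle
  have : BorelSpace Circle := ⟨rfl⟩
  let μ : Measure Circle := Measure.haar
  have hμ : (μ.real univ : ℂ) ≠ 0 := by
    have h0 : μ.real univ ≠ 0 := by
      simp only [μ, Measure.real, ne_eq, ENNReal.toReal_eq_zero_iff, measure_ne_top, or_false]
      exact isOpen_univ.measure_ne_zero _ univ_nonempty
    exact_mod_cast h0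
  have hmeas : MeasurableSet {z : Plane × Circle |
      g (planeRotation z.2 z.1) = (z.2 : ℂ) ^ n * g z.1} := by
    refine measurableSet_eq_fun (hg.comp continuous_planeRotation.measurable) ?_
    refine Measurable.mul ?_ (hg.comp measurable_fst)
    have : Continuous fun z : Plane × Circle => (z.2 : ℂ) ^ n := by fun_prop
    exact this.measurable
  -- The exceptional null set depends on `a`; Fubini turns it into a null set of `a` for almost
  -- every `x`.
  have h' : ∀ᵐ x : Plane, ∀ᵐ a ∂μ, g (planeRotation a x) = (a : ℂ) ^ n * g x :=
    (Measure.ae_ae_comm hmeas).2 (Eventually.of_forall h)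
  -- The profile at `r` is the Haar average of `a⁻ⁿ g` over the rotations of the point `(r, 0)`. An
  -- average is used because restricting `g` to a ray has no meaning almost everywhere.
  refine ⟨fun r => (μ.real univ : ℂ)⁻¹ *
    ∫ a, ((a : ℂ) ^ n)⁻¹ * g (planeRotation a (toComplex.symm (r : ℂ))) ∂μ, ?_⟩
  filter_upwards [h'] with x hx
  have h1 : ∫ a, ((a : ℂ) ^ n)⁻¹ * g (planeRotation a x) ∂μ = μ.real univ * g x := by
    have : ∫ a, ((a : ℂ) ^ n)⁻¹ * g (planeRotation a x) ∂μ = ∫ _, g x ∂μ := by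
      refine integral_congr_ae ?_
      filter_upwards [hx] with a ha
      rw [ha, inv_mul_cancel_left₀ (pow_ne_zero _ (Circle.coe_ne_zero a))]
    rw [this, integral_const, Complex.real_smul]
  -- Invariance under `a ↦ a · phase x` moves the base point from `(|x|, 0)` to `x` and yields the
  -- factor `(phase x)⁻ⁿ`.
  have h2 := integral_mul_right_eq_self (μ := μ) (fun a : Circle => ((a : ℂ) ^ n)⁻¹ *
    g (planeRotation a (toComplex.symm (‖x‖ : ℂ)))) (phase x)
  simp only [planeRotation_mul, planeRotation_phase, Circle.coe_mul, mul_pow, mul_inv,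
    mul_right_comm _ _ (g _)] at h2
  rw [integral_mul_const, h1] at h2
  rw [← h2, angular_eq]
  field_simp [Circle.coe_ne_zero (phase x)]

theorem measurable_toFun {s : ℕ} {γ : ℝ} (u : Sobolev s γ) : Measurable (toFun u) := by
  unfold toFun
  refine Measurable.mul ?_ (Lp.stronglyMeasurable _).measurable
  exact Complex.measurable_ofReal.comp
    (hasTemperateGrowth_bracket_rpow (-γ)).1.continuous.measurable

theorem locallyIntegrable_toFun {s : ℕ} {γ : ℝ} (u : Sobolev s γ) :
    LocallyIntegrable (toFun u) := by
  have h1 : LocallyIntegrable ((u : JetSpace s) ⟨(0, 0), Nat.zero_le s⟩ : Plane → ℂ) :=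
    (Lp.memLp _).locallyIntegrable (by norm_num)
  have h2 : Continuous fun x : Plane => ((bracket x ^ (-γ) : ℝ) : ℂ) :=
    Complex.continuous_ofReal.comp (hasTemperateGrowth_bracket_rpow (-γ)).1.continuous
  rw [← locallyIntegrableOn_univ] at h1 ⊢
  exact h1.continuousOn_mul h2.continuousOn isOpen_univ.isLocallyClosed

/-- Composition of a Schwartz function with a rotation. -/
def schwartzRotate (a : Circle) : 𝓢(Plane, ℂ) →L[ℂ] 𝓢(Plane, ℂ) :=
  compCLMOfContinuousLinearEquiv ℂ (planeRotation a).toContinuousLinearEquiv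

theorem schwartzRotate_apply (a : Circle) (f : 𝓢(Plane, ℂ)) (x : Plane) :
    schwartzRotate a f x = f (planeRotation a x) :=
  rfl

theorem helmholtz_schwartzRotate (a : Circle) (f : 𝓢(Plane, ℂ)) :
    helmholtz (schwartzRotate a f) = schwartzRotate a (helmholtz f) := by
  rw [helmholtz_eq_laplacian, helmholtz_eq_laplacian, map_sub]
  congr 1
  let b := EuclideanSpace.basisFun (Fin 2) ℝ
  -- The Laplacian is the same in every orthonormal basis; with the rotated basis on the right, the
  -- two sums agree term by term.
  rw [laplacian_eq_sum b, laplacian_eq_sum (b.map (planeRotation a)), map_sum]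
  refine Finset.sum_congr rfl fun i _ => ?_
  simp only [schwartzRotate, lineDerivOp_compCLMOfContinuousLinearEquiv]
  rfl

theorem integral_mul_schwartzRotate_inv (g : Plane → ℂ) (a : Circle) (f : 𝓢(Plane, ℂ)) :
    ∫ x, g x * schwartzRotate a⁻¹ f x = ∫ x, g (planeRotation a x) * f x := by
  rw [← (measurePreserving_planeRotation a).integral_comp
    (planeRotation a).toHomeomorph.measurableEmbedding]
  refine integral_congr_ae (Eventually.of_forall fun x => ?_)
  have h : planeRotation a⁻¹ (planeRotation a x) = x := by
    rw [← planeRotation_mul, inv_mul_cancel]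
    exact toComplex.injective (by simp [toComplex_planeRotation])
  simp only [schwartzRotate_apply, h]

/-- Elements of a mode space are characterised by their behaviour under rotations. -/
theorem mem_modeSpace_iff {n s : ℕ} {γ : ℝ} (u : Sobolev s γ) :
    u ∈ modeSpace n s γ ↔ ∀ (a : Circle) (f : 𝓢(Plane, ℂ)),
      ∫ x, toFun u x * schwartzRotate a⁻¹ f x = (a : ℂ) ^ n * ∫ x, toFun u x * f x := by
  constructor
  · rintro ⟨p, hp⟩ a f
    rw [integral_mul_schwartzRotate_inv, ← integral_const_mul]
    refine integral_congr_ae ?_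
    filter_upwards [hp, (measurePreserving_planeRotation a).quasiMeasurePreserving.ae hp,
      ae_ne_zero] with x h1 h2 hx
    rw [h1, h2, angular_planeRotation n a hx, LinearIsometryEquiv.norm_map]
    ring
  · intro h
    refine exists_profile_of_rotation (measurable_toFun u) n fun a => ?_
    have hr : LocallyIntegrable fun x => toFun u (planeRotation a x) := by
      refine (locallyIntegrable_map_homeomorph (f := toFun u) (μ := volume)
        (planeRotation a).toHomeomorph).1 ?_
      have : Measure.map (planeRotation a).toHomeomorph volume = (volume : Measure Plane) :=
        (measurePreserving_planeRotation a).map_eq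
      rw [this]
      exact locallyIntegrable_toFun u
    have hl : LocallyIntegrable fun x => (a : ℂ) ^ n * toFun u x :=
      (locallyIntegrable_toFun u).smul ((a : ℂ) ^ n)
    refine ae_eq_of_integral_contDiff_smul_eq hr hl fun φ hφ hφ' => ?_
    have ht : IsTest fun x => (φ x : ℂ) :=
      ⟨Complex.ofRealCLM.contDiff.comp hφ, hφ'.comp_left (g := ((↑) : ℝ → ℂ)) (by simp)⟩
    obtain ⟨f, hf⟩ := ht.exists_schwartz
    have h1 := h a f
    rw [integral_mul_schwartzRotate_inv, ← integral_const_mul] at h1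
    simp only [hf] at h1
    refine (integral_congr_ae (Eventually.of_forall fun x => ?_)).trans
      (h1.trans (integral_congr_ae (Eventually.of_forall fun x => ?_)))
    · simp [mul_comm]
    · simp only [Complex.real_smul]
      ring

/-- In the weak rotation criterion, `Δ - 1` moves onto the test function and commutes with its
rotation. The criterion for the image is thus that for `u` restricted to tests `(Δ - 1)f`, and these
are all Schwartz functions by surjectivity. -/
theorem sobolevHelmholtz_mem_modeSpace_iff {n s : ℕ} {γ : ℝ} (u : Sobolev (s + 2) γ) :
    sobolevHelmholtz s γ u ∈ modeSpace n s γ ↔ u ∈ modeSpace n (s + 2) γ := by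
  simp only [mem_modeSpace_iff, integral_sobolevHelmholtz_mul, helmholtz_schwartzRotate]
  refine forall_congr' fun a => ⟨fun h f => ?_, fun h f => h _⟩
  obtain ⟨k, rfl⟩ := helmholtz_surjective f
  exact h k

/-- The operator `Δ - 1` on the functions of the form `p(r) e^{inθ}`. -/
def modeHelmholtz (n s : ℕ) (γ : ℝ) : modeSpace n (s + 2) γ ≃L[ℂ] modeSpace n s γ :=
  (sobolevHelmholtz s γ).ofSubmodules _ _ (by
    ext v
    constructor
    · rintro ⟨u, hu, rfl⟩
      exact (sobolevHelmholtz_mem_modeSpace_iff u).2 hu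
    · intro hv
      refine ⟨(sobolevHelmholtz s γ).symm v, (sobolevHelmholtz_mem_modeSpace_iff _).1 ?_, ?_⟩
      · rwa [ContinuousLinearEquiv.apply_symm_apply]
      · exact (sobolevHelmholtz s γ).apply_symm_apply v)

/-! ### The radial equation. -/

theorem hasLineDerivAt_mul {f g : Plane → ℂ} {f' g' : ℂ} {x v : Plane}
    (hf : HasLineDerivAt ℝ f f' x v) (hg : HasLineDerivAt ℝ g g' x v) :
    HasLineDerivAt ℝ (fun y => f y * g y) (f' * g x + f x * g') x v := by
  have h := HasDerivAt.mul hf hg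
  simp only [zero_smul, add_zero] at h
  exact h

theorem hasLineDerivAt_comp_norm_sq {k : ℝ → ℂ} (i : Fin 2) (x : Plane)
    (h : DifferentiableAt ℝ k (‖x‖ ^ 2)) :
    HasLineDerivAt ℝ (fun y : Plane => k (‖y‖ ^ 2)) (2 * x i * deriv k (‖x‖ ^ 2)) x
      (EuclideanSpace.single i 1) := by
  have h1 := (h.hasDerivAt.hasFDerivAt.comp x
    (hasStrictFDerivAt_norm_sq x).hasFDerivAt).hasLineDerivAt (EuclideanSpace.single i (1 : ℝ))
  have e : 2 * (x i : ℂ) * deriv k (‖x‖ ^ 2) =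
      ((ContinuousLinearMap.toSpanSingleton ℝ (deriv k (‖x‖ ^ 2))).comp (2 • innerSL ℝ x))
        (EuclideanSpace.single i 1) := by
    simp [EuclideanSpace.inner_single_right, mul_assoc]
  rw [e]
  exact h1

/-- The complex conjugate of `x`, viewed as a complex number. -/
def conjCoord : Plane →L[ℝ] ℂ :=
  (Complex.conjCLE : ℂ →L[ℝ] ℂ) ∘L (toComplex : Plane →L[ℝ] ℂ)

theorem conjCoord_apply (x : Plane) : conjCoord x = x 0 - x 1 * Complex.I := by
  change (starRingEnd ℂ) (toComplex x) = _
  rw [toComplex_apply]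
  apply Complex.ext <;> simp

theorem angular_mul_conjCoord_pow (n : ℕ) (x : Plane) :
    angular n x * conjCoord x ^ n = (‖x‖ : ℂ) ^ n := by
  have h : conjCoord x = ‖x‖ * (starRingEnd ℂ) (phase x : ℂ) := by
    change (starRingEnd ℂ) (toComplex x) = _
    rw [← norm_mul_phase x, map_mul, Complex.conj_ofReal]
  have h1 : (phase x : ℂ) * (starRingEnd ℂ) (phase x : ℂ) = 1 := by
    rw [Complex.mul_conj, Circle.normSq_coe, Complex.ofReal_one]
  rw [angular_eq, h, ← mul_pow, mul_left_comm, h1, mul_one]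

theorem hasLineDerivAt_conjCoord_pow (m : ℕ) (x v : Plane) :
    HasLineDerivAt ℝ (fun y => conjCoord y ^ m)
      (m * conjCoord x ^ (m - 1) * conjCoord v) x v := by
  have h : HasDerivAt (fun t : ℝ => conjCoord (x + t • v)) (conjCoord v) 0 :=
    conjCoord.hasFDerivAt.hasLineDerivAt v
  have h1 := h.pow m
  simp only [zero_smul, add_zero] at h1
  exact h1

theorem hasLineDerivAt_coord (i : Fin 2) (x : Plane) :
    HasLineDerivAt ℝ (fun y : Plane => (y i : ℂ)) 1 x (EuclideanSpace.single i 1) := by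
  have h := ((Complex.ofRealCLM ∘L (EuclideanSpace.proj i : Plane →L[ℝ] ℝ)).hasFDerivAt
    (x := x)).hasLineDerivAt (EuclideanSpace.single i (1 : ℝ))
  have e : (1 : ℂ) = (Complex.ofRealCLM ∘L (EuclideanSpace.proj i : Plane →L[ℝ] ℝ))
      (EuclideanSpace.single i 1) := by
    simp
  rw [e]
  exact h

/-- The function `k(|x|²) z̄ⁿ`. -/
def conjMode (k : ℝ → ℂ) (n : ℕ) (x : Plane) : ℂ := k (‖x‖ ^ 2) * conjCoord x ^ n

theorem hasLineDerivAt_conjMode {k : ℝ → ℂ} (hk : Differentiable ℝ k) (n : ℕ) (i : Fin 2)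
    (x : Plane) : HasLineDerivAt ℝ (conjMode k n)
      (2 * (x i * conjMode (deriv k) n x) +
        n * conjCoord (EuclideanSpace.single i 1) * conjMode k (n - 1) x) x
      (EuclideanSpace.single i 1) := by
  have h := hasLineDerivAt_mul (hasLineDerivAt_comp_norm_sq i x (hk _))
    (hasLineDerivAt_conjCoord_pow n x (EuclideanSpace.single i 1))
  have e : 2 * (x i * conjMode (deriv k) n x) +
      n * conjCoord (EuclideanSpace.single i 1) * conjMode k (n - 1) x =
      2 * x i * deriv k (‖x‖ ^ 2) * conjCoord x ^ n +
        k (‖x‖ ^ 2) * (n * conjCoord x ^ (n - 1) * conjCoord (EuclideanSpace.single i 1)) := by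
    simp only [conjMode]
    ring
  rw [e]
  exact h

theorem schwartzDeriv_eq_of_hasLineDerivAt {f : 𝓢(Plane, ℂ)} {i : Fin 2} {x : Plane} {c : ℂ}
    (h : HasLineDerivAt ℝ f c x (EuclideanSpace.single i 1)) : schwartzDeriv i f x = c :=
  (lineDerivOp_apply (EuclideanSpace.single i (1 : ℝ)) f x).trans h.lineDeriv

/-- Since `z̄ⁿ` is harmonic and homogeneous of degree `n`, only `Δ(k(|x|²)) = 4|x|²k'' + 4k'` and
the Euler cross term `4n k'` survive. -/
theorem helmholtz_conjMode {k : ℝ → ℂ} (hk : ContDiff ℝ ∞ k) (n : ℕ) {f : 𝓢(Plane, ℂ)}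
    (hf : (f : Plane → ℂ) = conjMode k n) (x : Plane) :
    helmholtz f x = (4 * (‖x‖ ^ 2 * deriv (deriv k) (‖x‖ ^ 2) + (n + 1) * deriv k (‖x‖ ^ 2)) -
      k (‖x‖ ^ 2)) * conjCoord x ^ n := by
  have hk1 : ContDiff ℝ ∞ (deriv k) := ContDiff.deriv' hk
  have d0 : Differentiable ℝ k := hk.differentiable (by simp)
  have d1 : Differentiable ℝ (deriv k) := hk1.differentiable (by simp)
  have e1 : ∀ i, (schwartzDeriv i f : Plane → ℂ) = fun x =>
      2 * (x i * conjMode (deriv k) n x) +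
        n * conjCoord (EuclideanSpace.single i 1) * conjMode k (n - 1) x := fun i => by
    funext y
    apply schwartzDeriv_eq_of_hasLineDerivAt
    rw [hf]
    exact hasLineDerivAt_conjMode d0 n i y
  have e2 : ∀ i, schwartzDeriv i (schwartzDeriv i f) x =
      2 * (1 * conjMode (deriv k) n x + x i * (2 * (x i * conjMode (deriv (deriv k)) n x) +
        n * conjCoord (EuclideanSpace.single i 1) * conjMode (deriv k) (n - 1) x)) +
      n * conjCoord (EuclideanSpace.single i 1) * (2 * (x i * conjMode (deriv k) (n - 1) x) +
        (n - 1 : ℕ) * conjCoord (EuclideanSpace.single i 1) * conjMode k (n - 1 - 1) x) :=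
    fun i => by
    apply schwartzDeriv_eq_of_hasLineDerivAt
    rw [e1]
    exact HasDerivAt.add
      (((hasLineDerivAt_mul (hasLineDerivAt_coord i x)
        (hasLineDerivAt_conjMode d1 n i x)) : HasDerivAt _ _ _).const_mul 2)
      ((hasLineDerivAt_conjMode d0 (n - 1) i x : HasDerivAt _ _ _).const_mul _)
  -- The factor `n` makes this true for `n = 0` despite truncated subtraction.
  have hn : (n : ℂ) * conjCoord x ^ (n - 1) * conjCoord x = n * conjCoord x ^ n := by
    rcases n with _ | n
    · simp
    · rw [Nat.add_sub_cancel, mul_assoc, ← pow_succ]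
  have c0 : conjCoord (EuclideanSpace.single 0 1) = 1 := by simp [conjCoord_apply]
  have c1 : conjCoord (EuclideanSpace.single 1 1) = -Complex.I := by simp [conjCoord_apply]
  have hx : (‖x‖ : ℂ) ^ 2 = (x 0 : ℂ) ^ 2 + (x 1 : ℂ) ^ 2 := by
    have := EuclideanSpace.real_norm_sq_eq x
    rw [Fin.sum_univ_two] at this
    exact_mod_cast this
  rw [helmholtz_apply, sub_apply, add_apply, e2, e2, hf, c0, c1]
  rw [conjCoord_apply] at hn
  simp only [conjMode, hx]
  rw [conjCoord_apply]
  -- The first term is Euler's identity; the second is harmonicity of `z̄ⁿ`, in the form `1 + (-i)²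
  -- = 0`.
  linear_combination (4 * deriv k (‖x‖ ^ 2)) * hn +
    (n * k (‖x‖ ^ 2) * ((n - 1 : ℕ) : ℂ) * (x 0 - x 1 * Complex.I) ^ (n - 1 - 1)) * Complex.I_sq

/-- The function `k` with `ψ(r) = k(r²) rⁿ` for `r > 0`. -/
def radialQuotient (n : ℕ) (ψ : ℝ → ℂ) (t : ℝ) : ℂ := (Real.sqrt t ^ n)⁻¹ • ψ (Real.sqrt t)

/-- The square root and the division by `rⁿ` are singular only at `0`, near which `ψ` vanishes; for
`t ≤ 0` the real square root is `0`, so the quotient is zero there too. -/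
theorem contDiff_radialQuotient (n : ℕ) {ψ : ℝ → ℂ} (hψ : IsTest ψ) (h : tsupport ψ ⊆ Ioi 0) :
    ContDiff ℝ ∞ (radialQuotient n ψ) := by
  rw [contDiff_iff_contDiffAt]
  intro t
  rcases lt_or_ge 0 t with ht | ht
  · have h1 : ContDiffAt ℝ ∞ Real.sqrt t := Real.contDiffAt_sqrt ht.ne'
    exact ((h1.pow n).inv (pow_ne_zero _ (Real.sqrt_pos.2 ht).ne')).smul
      (hψ.1.contDiffAt.comp t h1)
  · have h0 : ψ =ᶠ[𝓝 (Real.sqrt t)] 0 := by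
      rw [Real.sqrt_eq_zero_of_nonpos ht]
      exact notMem_tsupport_iff_eventuallyEq.1 fun h' => lt_irrefl (0 : ℝ) (h h')
    have h1 : radialQuotient n ψ =ᶠ[𝓝 t] fun _ => 0 := by
      filter_upwards [Real.continuous_sqrt.continuousAt.eventually h0] with r hr
      simp [radialQuotient, hr]
    exact contDiffAt_const.congr_of_eventuallyEq h1

theorem radialQuotient_sq_mul (n : ℕ) (ψ : ℝ → ℂ) {r : ℝ} (hr : 0 < r) :
    radialQuotient n ψ (r ^ 2) * (r : ℂ) ^ n = ψ r := by
  have h : (r : ℂ) ≠ 0 := by exact_mod_cast hr.ne'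
  rw [radialQuotient, Real.sqrt_sq hr.le, Complex.real_smul]
  push_cast
  field_simp

theorem isTest_conjMode_radialQuotient (n : ℕ) {ψ : ℝ → ℂ} (hψ : IsTest ψ)
    (h : tsupport ψ ⊆ Ioi 0) : IsTest (conjMode (radialQuotient n ψ) n) := by
  constructor
  · exact ((contDiff_radialQuotient n hψ h).comp (contDiff_norm_sq ℝ)).mul
      (conjCoord.contDiff.pow n)
  · obtain ⟨R, hR⟩ := hψ.2.isCompact.isBounded.subset_closedBall 0
    refine HasCompactSupport.intro (isCompact_closedBall 0 R) fun x hx => ?_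
    have h0 : ψ ‖x‖ = 0 := image_eq_zero_of_notMem_tsupport fun h' => hx (by simpa using hR h')
    simp [conjMode, radialQuotient, Real.sqrt_sq (norm_nonneg x), h0]

theorem radial_laplacian_eq {k ψ : ℝ → ℂ} (hk : ContDiff ℝ ∞ k) (n : ℕ)
    (h : ∀ r, 0 < r → ψ r = k (r ^ 2) * (r : ℂ) ^ n) {r : ℝ} (hr : 0 < r) :
    deriv (deriv ψ) r + deriv ψ r / r - n ^ 2 / r ^ 2 * ψ r =
      4 * (r ^ 2 * deriv (deriv k) (r ^ 2) + (n + 1) * deriv k (r ^ 2)) * (r : ℂ) ^ n := by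
  have hk1 : ContDiff ℝ ∞ (deriv k) := ContDiff.deriv' hk
  have hsq : ∀ {l : ℝ → ℂ}, ContDiff ℝ ∞ l → ∀ t : ℝ,
      HasDerivAt (fun r => l (r ^ 2)) (2 * t * deriv l (t ^ 2)) t := fun {l} hl t => by
    have h1 := ((hl.differentiable (by simp) (t ^ 2)).hasDerivAt).scomp t (hasDerivAt_pow 2 t)
    have e : 2 * (t : ℂ) * deriv l (t ^ 2) = ((2 : ℕ) * t ^ (2 - 1)) • deriv l (t ^ 2) := by
      simp
    rw [e]
    exact h1
  have hid : ∀ t : ℝ, HasDerivAt (fun r : ℝ => (r : ℂ)) 1 t := fun t => by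
    simpa using (hasDerivAt_id t).ofReal_comp
  have hpow : ∀ (m : ℕ) (t : ℝ), HasDerivAt (fun r : ℝ => (r : ℂ) ^ m) (m * (t : ℂ) ^ (m - 1)) t :=
    fun m t => by
      have h1 := (hid t).pow m
      rw [mul_one] at h1
      exact h1
  have e1 : ∀ t, 0 < t → deriv ψ t = 2 * t * deriv k (t ^ 2) * (t : ℂ) ^ n +
      k (t ^ 2) * (n * (t : ℂ) ^ (n - 1)) := fun t ht => by
    have he : ψ =ᶠ[𝓝 t] fun r => k (r ^ 2) * (r : ℂ) ^ n := by
      filter_upwards [Ioi_mem_nhds ht] with r hr using h r hr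
    rw [he.deriv_eq]
    exact ((hsq hk t).mul (hpow n t)).deriv
  have he : deriv ψ =ᶠ[𝓝 r] fun t => 2 * t * deriv k (t ^ 2) * (t : ℂ) ^ n +
      k (t ^ 2) * (n * (t : ℂ) ^ (n - 1)) := by
    filter_upwards [Ioi_mem_nhds hr] with t ht using e1 t ht
  have e2 : deriv (deriv ψ) r = _ := he.deriv_eq.trans
    (((((hid r).const_mul 2).mul (hsq hk1 r)).mul (hpow n r)).add
      ((hsq hk r).mul ((hpow (n - 1) r).const_mul (n : ℂ)))).deriv
  have h0 : (r : ℂ) ≠ 0 := by exact_mod_cast hr.ne'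
  rw [e2, e1 r hr, h r hr]
  -- The exponents `n - 1` and `n - 1 - 1` truncate for `n = 0` and `n = 1`.
  rcases n with _ | _ | n
  · simp
    field_simp
    ring
  · simp
    field_simp
    ring
  · simp only [Nat.add_sub_cancel, Pi.mul_apply]
    push_cast
    field_simp
    ring

/-- The distributional equation `Δg - g = h` on the plane for `g = p(r) e^{inθ}` and
`h = q(r) e^{inθ}` implies the radial equation for `p` and `q`. -/
theorem LaplacianSubId.radial {g h : Plane → ℂ} {n : ℕ} {p q : ℝ → ℂ} (hgh : LaplacianSubId g h)
    (hg : g =ᵐ[volume] fun x => p ‖x‖ * angular n x)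
    (hh : h =ᵐ[volume] fun x => q ‖x‖ * angular n x) : RadialLaplacianSubId n p q := by
  intro ψ hψ hsupp
  have hk := contDiff_radialQuotient n hψ hsupp
  have ht := isTest_conjMode_radialQuotient n hψ hsupp
  have hrad : ∀ r, 0 < r → ψ r = radialQuotient n ψ (r ^ 2) * (r : ℂ) ^ n := fun r hr =>
    (radialQuotient_sq_mul n ψ hr).symm
  -- The test function `k(|x|²) z̄ⁿ` cancels the angular factor, as `e^{inθ} z̄ⁿ = |x|ⁿ`; both
  -- integrands become radial.
  have hmain := hgh _ ht
  obtain ⟨f, hf⟩ := ht.exists_schwartz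
  have hL : ∫ x, h x * conjMode (radialQuotient n ψ) n x =
      ∫ x : Plane, (fun r => q r * ψ r) ‖x‖ := by
    refine integral_congr_ae ?_
    filter_upwards [hh, ae_ne_zero] with x hx h0
    rw [hx, conjMode, hrad _ (norm_pos_iff.2 h0)]
    linear_combination q ‖x‖ * radialQuotient n ψ (‖x‖ ^ 2) * angular_mul_conjCoord_pow n x
  have hR : ∫ x, g x * ((Δ (conjMode (radialQuotient n ψ) n)) x -
      conjMode (radialQuotient n ψ) n x) = ∫ x : Plane, (fun r => p r * (deriv (deriv ψ) r +
        deriv ψ r / r - n ^ 2 / r ^ 2 * ψ r - ψ r)) ‖x‖ := by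
    refine integral_congr_ae ?_
    filter_upwards [hg, ae_ne_zero] with x hx h0
    have e : (Δ (conjMode (radialQuotient n ψ) n)) x - conjMode (radialQuotient n ψ) n x =
        helmholtz f x := by
      rw [helmholtz_eq_laplacian, sub_apply, laplacian_apply, hf]
    rw [e, hx, helmholtz_conjMode hk n hf, radial_laplacian_eq hk n hrad (norm_pos_iff.2 h0),
      hrad _ (norm_pos_iff.2 h0)]
    linear_combination p ‖x‖ * (4 * (‖x‖ ^ 2 * deriv (deriv (radialQuotient n ψ)) (‖x‖ ^ 2) +
      (n + 1) * deriv (radialQuotient n ψ) (‖x‖ ^ 2)) - radialQuotient n ψ (‖x‖ ^ 2)) *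
        angular_mul_conjCoord_pow n x
  have hdim : Module.finrank ℝ Plane = 2 := by simp
  have hball : (volume : Measure Plane).real (Metric.ball 0 1) ≠ 0 :=
    (ENNReal.toReal_pos (Metric.measure_ball_pos volume _ one_pos).ne' measure_ball_lt_top.ne).ne'
  -- Both sides of the equation acquire the same nonzero constant, twice the area of the unit disc,
  -- which cancels at the end.
  have hpolar : ∀ F : ℝ → ℂ, ∫ x : Plane, F ‖x‖ =
      2 • (volume : Measure Plane).real (Metric.ball 0 1) • ∫ r in Ioi (0 : ℝ), F r * r := by
    intro F
    rw [integral_fun_norm_addHaar, hdim]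
    simp [mul_comm]
  rw [hL, hR, hpolar (fun r => q r * ψ r), hpolar (fun r => p r * (deriv (deriv ψ) r +
    deriv ψ r / r - n ^ 2 / r ^ 2 * ψ r - ψ r))] at hmain
  exact smul_right_injective ℂ hball (smul_right_injective ℂ (two_ne_zero : (2 : ℕ) ≠ 0) hmain)

end WeightedSobolev

end

theorem mainTheorem6 (s : ℕ) (hs : 2 ≤ s) (γ : ℝ) :
    (∃ T : WeightedSobolev.Sobolev s γ ≃L[ℂ] WeightedSobolev.Sobolev (s - 2) γ,
      ∀ u : WeightedSobolev.Sobolev s γ,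
        WeightedSobolev.LaplacianSubId (WeightedSobolev.toFun u) (WeightedSobolev.toFun (T u))) ∧
    ∀ n : ℕ,
      ∃ S : WeightedSobolev.modeSpace n s γ ≃L[ℂ] WeightedSobolev.modeSpace n (s - 2) γ,
        ∀ (u : WeightedSobolev.modeSpace n s γ) (p q : ℝ → ℂ),
          WeightedSobolev.IsProfile n p u.1 → WeightedSobolev.IsProfile n q (S u).1 →
            WeightedSobolev.RadialLaplacianSubId n p q := by
  obtain ⟨s, rfl⟩ := Nat.exists_eq_add_of_le' hs
  exact ⟨⟨WeightedSobolev.sobolevHelmholtz s γ, WeightedSobolev.laplacianSubId_sobolevHelmholtz⟩,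
    fun n => ⟨WeightedSobolev.modeHelmholtz n s γ, fun u p q hp hq =>
      (WeightedSobolev.laplacianSubId_sobolevHelmholtz u.1).radial hp hq⟩⟩
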